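/- **Setting.** For $n\ge 1$ let $(\mathcal X_n,K_n,\pi_n)$ be an irreducible Markov chain: $\mathcal X_n$ is a countable set, $K_n$ is an irreducible stochastic matrix indexed by $\mathcal X_n$, and $\pi_n$ is a stationary probability of $K_n$. Write $\mathcal F=(\mathcal X_n,K_n,\pi_n)_{n\ge1}$. For any such chain $(\mathcal X,K,\pi)$ the associated continuous time chain has transition matrices $H_t=e^{-t(I-K)}=\sum_{m\ge0}e^{-t}\frac{t^m}{m!}K^m$, $t\ge 0$, and its maximum total variation and Hellinger distances are $$d^{(c)}_{\rm TV}(t)=\sup_{x\in\mathcal X,\,S\subset\mathcal X}\{H_t(x,S)-\pi(S)\},\qquad d^{(c)}_{H}(t)=\sup_{x\in\mathcal X}\Big(\tfrac12\sum_{y\in\mathcal X}\big(\sqrt{H_t(x,y)}-\sqrt{\pi(y)}\big)^2\Big)^{1/2},$$ with mixing times $T^{(c)}_*(\epsilon)=\inf\{t\ge0: d^{(c)}_*(t)\le\epsilon\}\in[0,\infty]$ for $*\in\{{\rm TV},H\}$. A family of continuous time chains with distances $d^{(c)}_{n,*}$ has a cutoff in $*$ with cutoff time $(t_n)$ if $t_n>0$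 for all $n$, $\lim_n d^{(c)}_{n,*}(at_n)=0$ for all $a>1$, and $\lim_n d^{(c)}_{n,*}(at_n)=1$ for all $a\in(0,1)$; it has a cutoff if such a sequence $(t_n)$ exists. Let $(p_n)_{n\ge1}$ be positive reals and $q_n=p_1+\cdots+p_n$. Let $\mathcal F^{\mathcal P}$ be the family whose $n$th chain is the product of the first $n$ chains according to $(p_1/q_n,\dots,p_n/q_n)$, i.e. the chain on $\mathcal X_1\times\cdots\times\mathcal X_n$ with transition matrix $\sum_{i=1}^n\frac{p_i}{q_n}\,I\otimes\cdots\otimes I\otimes K_i\otimes I\otimes\cdots\otimes I$ ($K_i$ in the $i$th place) and stationary distribution $\pi_1\times\cdots\times\pi_n$. Let $\mathcal F_c$ and $\mathcal F^{\mathcal P}_c$ be the families of continuous time chains associated with $\mathcal F$ and $\mathcal F^{\mathcal P}$. A subfamily of $\mathcal F_c$ is the family of its chains with indices $\xi_1<\xi_2<\cdots$, for a strictly increasing sequence $(\xi_n)$ of positive integers. **Theorem.** Let $(\epsilon_n)$ satisfy $0<\inf_n\epsilon_n\le\sup_n\epsilon_n<1/2$, let $T^{(c)}_{n,{\rm TV}}$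 be the total variation mixing time of the $n$th chain of $\mathcal F_c$, and suppose that for all $n\ge1$ $$D_n:=\log\frac{T^{(c)}_{n,{\rm TV}}(\epsilon_n)}{p_n}=A_nn+B_n+C_n$$ with real numbers $A_n,B_n,C_n$ (in particular $0<T^{(c)}_{n,{\rm TV}}(\epsilon_n)<\infty$). Assume that (I) either $0<A_n\le A_{n+1}$ for all $n$, or there is $A>0$ such that $n|A_n-A|$ is bounded; (II) $B_n$ is nondecreasing, $C_n$ is bounded, and $D_n$ is nondecreasing for $n$ large enough. Then, in the total variation: (1) if $\mathcal F_c$ has a cutoff with cutoff time $t_n$, then $\mathcal F^{\mathcal P}_c$ has a cutoff with cutoff time $(p_1+\cdots+p_n)t_n/p_n$; (2) if no subfamily of $\mathcal F_c$ has a cutoff, then $\mathcal F^{\mathcal P}_c$ has no cutoff. The same conclusions hold in the Hellinger distance if $\sup_n\epsilon_n<1/4$ and $T^{(c)}_{n,{\rm TV}}$ is replaced by $T^{(c)}_{n,H}$, the mixing time of the $n$th chain of $\mathcal F_c$ in the Hellinger distance. -/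

import Mathlib

open Filter Topology
open scoped ENNReal BigOperators

namespace ProductChain

universe u v

noncomputable section

/-- The identity matrix indexed by an arbitrary set. -/
def idMat {X : Type u} (x y : X) : ℝ :=
  open Classical in if x = y then 1 else 0

/-- The `m`-step transition probabilities `K^m(x,y)` of a transition matrix `K`. -/
def stepPow {X : Type u} (K : X → X → ℝ) : ℕ → X → X → ℝ
  | 0 => idMat
  | m + 1 => fun x y => ∑' z, K x z * stepPow K m z y

/-- `(X, K, π)` is an irreducible Markov chain: `K` is an irreducible stochastic matrix indexed
by `X`, and `π` is a probability on `X` that is stationary for `K`. -/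
structure IsIrreducibleChain {X : Type u} (K : X → X → ℝ) (π : X → ℝ) : Prop where
  nonneg : ∀ x y, 0 ≤ K x y
  row_sum : ∀ x, HasSum (K x) 1
  irreducible : ∀ x y, ∃ m : ℕ, 0 < stepPow K m x y
  prob_nonneg : ∀ x, 0 ≤ π x
  prob_sum : HasSum π 1
  stationary : ∀ y, HasSum (fun x => π x * K x y) (π y)

/-- The transition matrix `H_t = e^{-t(I-K)} = ∑ₘ e^{-t} (t^m / m!) K^m` at time `t ≥ 0` of the
continuous time chain associated with `K`. -/
def heat {X : Type u} (K : X → X → ℝ) (t : ℝ) (x y : X) : ℝ :=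
  ∑' m : ℕ, Real.exp (-t) * (t ^ m / (m.factorial : ℝ)) * stepPow K m x y

/-- The maximum total variation of the continuous time chain,
`sup {H_t(x, S) - π(S) : x ∈ X, S ⊆ X}`. -/
def dTV {X : Type u} (K : X → X → ℝ) (π : X → ℝ) (t : ℝ) : ℝ :=
  ⨆ q : X × Set X, ((∑' y : q.2, heat K t q.1 y) - ∑' y : q.2, π y)

/-- The maximum Hellinger distance of the continuous time chain. -/
def dH {X : Type u} (K : X → X → ℝ) (π : X → ℝ) (t : ℝ) : ℝ :=
  ⨆ x : X, Real.sqrt (1 / 2 * ∑' y, (Real.sqrt (heat K t x y) - Real.sqrt (π y)) ^ 2)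

/-- The mixing time `inf {t ≥ 0 : d(t) ≤ ε}`, with `inf ∅ = ∞`. -/
def mixingTime (d : ℝ → ℝ) (ε : ℝ) : ℝ≥0∞ :=
  ⨅ (t : ℝ) (_ : 0 ≤ t ∧ d t ≤ ε), ENNReal.ofReal t

/-- A family of chains with distances `d n` has a cutoff with cutoff time `t n`. -/
def IsCutoffTime (d : ℕ → ℝ → ℝ) (t : ℕ → ℝ) : Prop :=
  (∀ n, 0 < t n) ∧
  (∀ a : ℝ, 1 < a → Tendsto (fun n => d n (a * t n)) atTop (𝓝 0)) ∧
  (∀ a : ℝ, 0 < a → a < 1 → Tendsto (fun n => d n (a * t n)) atTop (𝓝 1))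

/-- A family of chains with distances `d n` has a cutoff. -/
def HasCutoff (d : ℕ → ℝ → ℝ) : Prop :=
  ∃ t : ℕ → ℝ, IsCutoffTime d t

/-- The matrix `∑ᵢ wᵢ I ⊗ ⋯ ⊗ I ⊗ Kᵢ ⊗ I ⊗ ⋯ ⊗ I` on the product of the state spaces. -/
def prodMat {ι : Type v} [Fintype ι] [DecidableEq ι] {Y : ι → Type u} (w : ι → ℝ)
    (K : ∀ i, Y i → Y i → ℝ) (x y : ∀ i, Y i) : ℝ :=
  ∑ i, w i * (K i (x i) (y i) * ∏ j ∈ Finset.univ.erase i, idMat (x j) (y j))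

/-- `q_n`, the sum of the weights of the first chains up to index `n`. -/
def weightSum (p : ℕ → ℝ) (n : ℕ) : ℝ :=
  ∑ i ∈ Finset.range (n + 1), p i

/-- The transition matrix of the product of the chains with indices `0, …, n` according to the
probability vector `(p 0 / q_n, …, p n / q_n)`. -/
def productK {X : ℕ → Type u} (K : ∀ n, X n → X n → ℝ) (p : ℕ → ℝ) (n : ℕ) :
    (∀ i : Fin (n + 1), X i) → (∀ i : Fin (n + 1), X i) → ℝ :=
  prodMat (fun i : Fin (n + 1) => p i / weightSum p n) (fun i : Fin (n + 1) => K i)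

/-- The product of the stationary distributions of the chains with indices `0, …, n`. -/
def productPi {X : ℕ → Type u} (π : ∀ n, X n → ℝ) (n : ℕ) (x : ∀ i : Fin (n + 1), X i) : ℝ :=
  ∏ i : Fin (n + 1), π i (x i)

end

end ProductChain

/-! Both distances come from an affinity `∑ y, φ (a y) (b y)` of distributions: `φ = min` gives the
total variation and the geometric mean gives the square of the Hellinger distance. An affinity does
not decrease under kernels and is supermultiplicative on products. At time `q_n t` the product chain
is the product of the chains `i ≤ n` at the times `p_i t`, so its distance is at least each
`d_i (p_i t)`, and one minus it is at least `∏ i, (1 - d_i (p_i t))`.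

Write the mixing times as `T_n = p_n E_n`, where `E_n = exp D_n` grows geometrically. As the
distances are submultiplicative in time up to a constant, `d_i (p_i t)` is `O (E_i / t)`, so at
times `t` of order `E_n` the factors other than the last `k` contribute at most `O (ρ ^ k)` with
`ρ < 1`.

If the factors have a cutoff at `t_n`, then `t_n / p_n` is asymptotic to the eventually monotone
`E_n`, so that none of the last `k` factors mixes later than the last one, asymptotically. If the
product has a cutoff at `q_n τ_n`, then shortly before it one of the last `k` factors is at distance
close to `1`, while shortly after it all of them are close to equilibrium; these factors form a
subfamily with a cutoff. -/

namespace ProductChain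

noncomputable section

/-! ### Cutoffs under geometric growth -/

theorem one_sub_sum_le_prod_one_sub {ι R : Type*} [CommRing R] [LinearOrder R]
    [IsStrictOrderedRing R] {s : Finset ι} {f : ι → R} (h0 : ∀ i ∈ s, 0 ≤ f i)
    (h1 : ∀ i ∈ s, f i ≤ 1) : 1 - ∑ i ∈ s, f i ≤ ∏ i ∈ s, (1 - f i) := by
  induction s using Finset.cons_induction with
  | empty => simp
  | cons a s ha ih =>
    simp only [Finset.forall_mem_cons] at h0 h1
    rw [Finset.sum_cons, Finset.prod_cons]
    calc 1 - (f a + ∑ i ∈ s, f i)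
        ≤ (1 - f a) * (1 - ∑ i ∈ s, f i) := by
          linarith [mul_nonneg h0.1 (Finset.sum_nonneg h0.2)]
      _ ≤ (1 - f a) * ∏ i ∈ s, (1 - f i) :=
          mul_le_mul_of_nonneg_left (ih h0.2 h1.2) (sub_nonneg.2 h1.1)

@[to_additive]
theorem prod_range_succ_eq_prod_mul_prod_sub {M : Type*} [CommMonoid M] (f : ℕ → M) {n k : ℕ}
    (hk : k ≤ n + 1) :
    ∏ i ∈ Finset.range (n + 1), f i =
      (∏ i ∈ Finset.range (n + 1 - k), f i) * ∏ j ∈ Finset.range k, f (n - j) := by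
  induction k with
  | zero => simp
  | succ k ih =>
    rw [ih (by omega), Nat.succ_sub (by omega : k ≤ n), Finset.prod_range_succ,
      Finset.prod_range_succ _ k, Nat.add_sub_add_right, mul_assoc, mul_comm (f (n - k))]

theorem sum_geometric_reflect_le {ρ : ℝ} (h0 : 0 ≤ ρ) (h1 : ρ < 1) (n k : ℕ) :
    ∑ i ∈ Finset.range (n + 1 - k), ρ ^ (n - i) ≤ ρ ^ k * (1 - ρ)⁻¹ := by
  have reindex : ∑ i ∈ Finset.range (n + 1 - k), ρ ^ (n - i) =
      ρ ^ k * ∑ j ∈ Finset.range (n + 1 - k), ρ ^ j := by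
    rw [← Finset.sum_range_reflect, Finset.mul_sum]
    refine Finset.sum_congr rfl fun j hj ↦ ?_
    have := Finset.mem_range.1 hj
    rw [← pow_add]
    congr 1
    omega
  rw [reindex, ← tsum_geometric_of_lt_one h0 h1]
  gcongr
  exact (summable_geometric_of_lt_one h0 h1).sum_le_tsum _ fun i _ ↦ pow_nonneg h0 i

/-- The relation between the distances `d n` of a sequence of chains and the distances `P n` of
their products with weights `p`. In the product the `i`th chain runs at speed
`p i / weightSum p n`, so that it is at time `p i * t` when the product is at time
`weightSum p n * t`. -/
structure IsProductDist (d P : ℕ → ℝ → ℝ) (p : ℕ → ℝ) : Prop where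
  weight_pos : ∀ n, 0 < p n
  nonneg : ∀ n ⦃t⦄, 0 ≤ t → 0 ≤ d n t
  le_one : ∀ n ⦃t⦄, 0 ≤ t → d n t ≤ 1
  antitoneOn : ∀ n, AntitoneOn (d n) (Set.Ici 0)
  prod_le_one : ∀ n ⦃t⦄, 0 ≤ t → P n t ≤ 1
  le_prod : ∀ ⦃i n t⦄, i ≤ n → 0 ≤ t → d i (p i * t) ≤ P n (weightSum p n * t)
  prod_one_sub_le : ∀ n ⦃t⦄, 0 ≤ t →
    ∏ i ∈ Finset.range (n + 1), (1 - d i (p i * t)) ≤ 1 - P n (weightSum p n * t)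

/-- `T n` is a time at which the distance `d n` passes from values bounded away from `0` to values
bounded away from `1`, uniformly in `n`, and on whose scale `d n` decays. -/
structure IsTimeScale (d : ℕ → ℝ → ℝ) (T : ℕ → ℝ) : Prop where
  pos : ∀ n, 0 < T n
  lower : ∃ a, 0 < a ∧ ∀ n t, 0 ≤ t → t < T n → a ≤ d n t
  upper : ∃ b, b < 1 ∧ ∀ n t, T n < t → d n t ≤ b
  decay : ∃ C, 0 < C ∧ ∀ n t, 0 < t → d n t ≤ C * (T n / t)

/-- The sequence `E` grows at least geometrically, up to a multiplicative constant. -/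
def HasGeometricGrowth (E : ℕ → ℝ) : Prop :=
  ∃ M ρ : ℝ, 0 < M ∧ 0 < ρ ∧ ρ < 1 ∧ ∀ ⦃i n⦄, i ≤ n → E i ≤ M * ρ ^ (n - i) * E n

theorem weightSum_pos {p : ℕ → ℝ} (hp : ∀ n, 0 < p n) (n : ℕ) : 0 < weightSum p n :=
  Finset.sum_pos (fun i _ ↦ hp i) ⟨0, by simp⟩

section TimeScale

variable {d : ℕ → ℝ → ℝ} {T t : ℕ → ℝ}

theorem IsTimeScale.eventually_le (hT : IsTimeScale d T) (ht : ∀ n, 0 < t n)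
    (hlim : Tendsto (fun n ↦ d n (t n)) atTop (𝓝 0)) : ∀ᶠ n in atTop, T n ≤ t n := by
  obtain ⟨a, ha, hlower⟩ := hT.lower
  filter_upwards [hlim.eventually_lt_const ha] with n hn
  exact not_lt.1 fun h ↦ hn.not_ge (hlower n (t n) (ht n).le h)

theorem IsTimeScale.eventually_ge (hT : IsTimeScale d T)
    (hlim : Tendsto (fun n ↦ d n (t n)) atTop (𝓝 1)) : ∀ᶠ n in atTop, t n ≤ T n := by
  obtain ⟨b, hb, hupper⟩ := hT.upper
  filter_upwards [hlim.eventually_const_lt hb] with n hn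
  exact not_lt.1 fun h ↦ hn.not_ge (hupper n (t n) h)

/-- A cutoff time is asymptotic to every time scale, so it inherits the monotonicity of `E`
approximately. -/
theorem IsTimeScale.eventually_cutoffTime_sub_le {E p : ℕ → ℝ}
    (hT : IsTimeScale d fun n ↦ p n * E n) (hp : ∀ n, 0 < p n)
    (hmono : ∃ N, MonotoneOn E (Set.Ici N)) (ht : IsCutoffTime d t) {c : ℝ} (hc : 1 < c)
    (j : ℕ) : ∀ᶠ n in atTop, t (n - j) / p (n - j) ≤ c * (t n / p n) := by
  obtain ⟨N, hN⟩ := hmono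
  obtain ⟨r, hr, hrc⟩ := exists_between hc
  have r0 : 0 < r := zero_lt_one.trans hr
  have c0 : 0 < c := zero_lt_one.trans hc
  have upper : ∀ᶠ n in atTop, p n * E n ≤ r * t n :=
    hT.eventually_le (fun n ↦ mul_pos r0 (ht.1 n)) (ht.2.1 r hr)
  have lower : ∀ᶠ n in atTop, r / c * t n ≤ p n * E n :=
    hT.eventually_ge (ht.2.2 (r / c) (by positivity) ((div_lt_one c0).2 hrc))
  filter_upwards [upper, (tendsto_sub_atTop_nat j).eventually lower,
    eventually_ge_atTop (N + j)] with n h_up h_low hn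
  have hE : E (n - j) ≤ E n := hN (by simp; omega) (by simp; omega) (by omega)
  have h1 : E n ≤ r * (t n / p n) := by
    rw [← mul_div_assoc, le_div_iff₀ (hp n)]
    linarith
  have h2 : r / c * (t (n - j) / p (n - j)) ≤ E (n - j) := by
    rw [← mul_div_assoc, div_le_iff₀ (hp _)]
    linarith
  calc t (n - j) / p (n - j) = c / r * (r / c * (t (n - j) / p (n - j))) := by field_simp
    _ ≤ c / r * (r * (t n / p n)) := 
        mul_le_mul_of_nonneg_left (h2.trans (hE.trans h1)) (by positivity)
    _ = c * (t n / p n) := by field_simp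

end TimeScale

namespace IsProductDist

variable {d P : ℕ → ℝ → ℝ} {p E : ℕ → ℝ}

theorem prod_le_sum (h : IsProductDist d P p) (n : ℕ) {t : ℝ} (ht : 0 ≤ t) :
    P n (weightSum p n * t) ≤ ∑ i ∈ Finset.range (n + 1), d i (p i * t) := by
  have hpt : ∀ i, 0 ≤ p i * t := fun i ↦ mul_nonneg (h.weight_pos i).le ht
  have union_bound := one_sub_sum_le_prod_one_sub (s := Finset.range (n + 1))
    (fun i _ ↦ h.nonneg i (hpt i)) (fun i _ ↦ h.le_one i (hpt i))
  linarith [h.prod_one_sub_le n ht]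

theorem prod_nonneg (h : IsProductDist d P p) (n : ℕ) {t : ℝ} (ht : 0 ≤ t) :
    0 ≤ P n (weightSum p n * t) :=
  (h.nonneg n (mul_nonneg (h.weight_pos n).le ht)).trans (h.le_prod le_rfl ht)

theorem exists_sum_le (h : IsProductDist d P p) (hT : IsTimeScale d fun n ↦ p n * E n)
    (hE : HasGeometricGrowth E) : ∃ G ρ : ℝ, 0 < G ∧ 0 < ρ ∧ ρ < 1 ∧
      ∀ (n k : ℕ) (c s : ℝ), 0 < s → E n ≤ c * s →
        ∑ i ∈ Finset.range (n + 1 - k), d i (p i * s) ≤ G * c * ρ ^ k := by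
  obtain ⟨C, hC, hdecay⟩ := hT.decay
  obtain ⟨M, ρ, hM, hρ0, hρ1, hgrowth⟩ := hE
  have : 0 < 1 - ρ := sub_pos.2 hρ1
  refine ⟨C * M * (1 - ρ)⁻¹, ρ, by positivity, hρ0, hρ1, fun n k c s hs hEs ↦ ?_⟩
  have En : 0 < E n := pos_of_mul_pos_right (hT.pos n) (h.weight_pos n).le
  have term : ∀ i ≤ n, d i (p i * s) ≤ C * M * (E n / s) * ρ ^ (n - i) := fun i hi ↦ by
    have hp := h.weight_pos i
    calc d i (p i * s) ≤ C * (p i * E i / (p i * s)) := hdecay i _ (by positivity)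
      _ = C * (E i / s) := by field_simp
      _ ≤ C * (M * ρ ^ (n - i) * E n / s) := by gcongr; exact hgrowth hi
      _ = C * M * (E n / s) * ρ ^ (n - i) := by ring
  calc ∑ i ∈ Finset.range (n + 1 - k), d i (p i * s)
      ≤ ∑ i ∈ Finset.range (n + 1 - k), C * M * (E n / s) * ρ ^ (n - i) :=
        Finset.sum_le_sum fun i hi ↦ term i (by have := Finset.mem_range.1 hi; omega)
    _ = C * M * (E n / s) * ∑ i ∈ Finset.range (n + 1 - k), ρ ^ (n - i) :=
        (Finset.mul_sum ..).symm
    _ ≤ C * M * c * (ρ ^ k * (1 - ρ)⁻¹) := by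
        gcongr
        · exact mul_nonneg (by positivity)
            (nonneg_of_mul_nonneg_left (En.le.trans hEs) hs)
        · exact (div_le_iff₀ hs).2 hEs
        · exact sum_geometric_reflect_le hρ0.le hρ1 n k
    _ = C * M * (1 - ρ)⁻¹ * c * ρ ^ k := by ring

theorem tendsto_prod_zero (h : IsProductDist d P p) (hT : IsTimeScale d fun n ↦ p n * E n)
    (hE : HasGeometricGrowth E) {s : ℕ → ℝ} (hs : ∀ n, 0 < s n)
    (hEs : ∀ᶠ n in atTop, E n ≤ s n)
    (hlast : ∀ j, Tendsto (fun n ↦ d (n - j) (p (n - j) * s n)) atTop (𝓝 0)) :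
    Tendsto (fun n ↦ P n (weightSum p n * s n)) atTop (𝓝 0) := by
  obtain ⟨G, ρ, hG, -, hρ1, htail⟩ := h.exists_sum_le hT hE
  refine tendsto_order.2 ⟨fun a ha ↦ .of_forall fun n ↦ ha.trans_le (h.prod_nonneg n (hs n).le),
    fun η hη ↦ ?_⟩
  obtain ⟨k, hk⟩ : ∃ k : ℕ, ρ ^ k < η / 2 / G := exists_pow_lt_of_lt_one (by positivity) hρ1
  rw [lt_div_iff₀ hG] at hk
  have last : Tendsto (fun n ↦ ∑ j ∈ Finset.range k, d (n - j) (p (n - j) * s n)) atTop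
      (𝓝 0) := by
    simpa only [Finset.sum_const_zero] using
      tendsto_finsetSum (Finset.range k) fun j _ ↦ hlast j
  filter_upwards [hEs, last.eventually_lt_const (half_pos hη), eventually_ge_atTop k]
    with n hEn hlast_n hkn
  have tail := htail n k 1 (s n) (hs n) (by rwa [one_mul])
  have split := h.prod_le_sum n (hs n).le
  rw [sum_range_succ_eq_sum_add_sum_sub _ (by omega : k ≤ n + 1)] at split
  linarith

theorem tendsto_last_zero (h : IsProductDist d P p) (hT : IsTimeScale d fun n ↦ p n * E n)
    (hmono : ∃ N, MonotoneOn E (Set.Ici N)) {t : ℕ → ℝ} (ht : IsCutoffTime d t) {a : ℝ}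
    (ha : 1 < a) (j : ℕ) :
    Tendsto (fun n ↦ d (n - j) (p (n - j) * (a * (t n / p n)))) atTop (𝓝 0) := by
  obtain ⟨r, hr, hra⟩ := exists_between ha
  have r0 : 0 < r := zero_lt_one.trans hr
  have hc : 1 < a / r := (one_lt_div r0).2 hra
  refine squeeze_zero' (.of_forall fun n ↦ h.nonneg _ ?_) ?_
    ((ht.2.1 r hr).comp (tendsto_sub_atTop_nat j))
  · have := ht.1 n
    have := h.weight_pos n
    have := h.weight_pos (n - j)
    positivity
  filter_upwards [hT.eventually_cutoffTime_sub_le h.weight_pos hmono ht hc j] with n hn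
  have hp := h.weight_pos (n - j)
  have hle : r * t (n - j) ≤ p (n - j) * (a * (t n / p n)) := by
    calc r * t (n - j) = p (n - j) * (r * (t (n - j) / p (n - j))) := by field_simp
      _ ≤ p (n - j) * (r * (a / r * (t n / p n))) := by gcongr
      _ = p (n - j) * (a * (t n / p n)) := by field_simp
  have h0 : 0 ≤ r * t (n - j) := (mul_pos r0 (ht.1 _)).le
  exact h.antitoneOn _ h0 (h0.trans hle) hle

theorem isCutoffTime_prod (h : IsProductDist d P p) (hT : IsTimeScale d fun n ↦ p n * E n)
    (hE : HasGeometricGrowth E) (hmono : ∃ N, MonotoneOn E (Set.Ici N)) {t : ℕ → ℝ}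
    (ht : IsCutoffTime d t) : IsCutoffTime P fun n ↦ weightSum p n * t n / p n := by
  have hs : ∀ n, 0 < t n / p n := fun n ↦ div_pos (ht.1 n) (h.weight_pos n)
  have normalize : ∀ a n, a * (weightSum p n * t n / p n) = weightSum p n * (a * (t n / p n)) :=
    fun a n ↦ by ring
  refine ⟨fun n ↦ ?_, fun a ha ↦ ?_, fun a ha0 ha1 ↦ ?_⟩
  · exact div_pos (mul_pos (weightSum_pos h.weight_pos n) (ht.1 n)) (h.weight_pos n)
  · have a0 : 0 < a := zero_lt_one.trans ha
    simp only [normalize]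
    refine h.tendsto_prod_zero hT hE (fun n ↦ mul_pos a0 (hs n)) ?_
      (h.tendsto_last_zero hT hmono ht ha)
    filter_upwards [hT.eventually_le (fun n ↦ mul_pos a0 (ht.1 n)) (ht.2.1 a ha)] with n hn
    rw [← mul_div_assoc, le_div_iff₀ (h.weight_pos n)]
    linarith
  · simp only [normalize]
    have h0 : ∀ n, 0 ≤ a * (t n / p n) := fun n ↦ (mul_pos ha0 (hs n)).le
    refine tendsto_of_tendsto_of_tendsto_of_le_of_le (ht.2.2 a ha0 ha1) tendsto_const_nhds
      (fun n ↦ ?_) (fun n ↦ h.prod_le_one n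
        (mul_nonneg (weightSum_pos h.weight_pos n).le (h0 n)))
    have last_le := h.le_prod (le_refl n) (h0 n)
    rwa [mul_left_comm, mul_div_cancel₀ _ (h.weight_pos n).ne'] at last_le

/-- By the tail bound the chains with index below `n - k` are close to equilibrium, hence a
product close to distance `1` needs one of the last `k` chains to be close to distance `1`. -/
theorem exists_eventually_exists_one_sub_le (h : IsProductDist d P p)
    (hT : IsTimeScale d fun n ↦ p n * E n) (hE : HasGeometricGrowth E) {s : ℕ → ℝ} {c δ : ℝ}
    (hs : ∀ n, 0 < s n) (hEs : ∀ᶠ n in atTop, E n ≤ c * s n)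
    (hlim : Tendsto (fun n ↦ P n (weightSum p n * s n)) atTop (𝓝 1)) (hδ : 0 < δ) :
    ∃ k, ∀ᶠ n in atTop, ∃ i ≤ n, n ≤ i + k ∧ 1 - δ ≤ d i (p i * s n) := by
  obtain ⟨G, ρ, -, hρ0, hρ1, htail⟩ := h.exists_sum_le hT hE
  obtain ⟨k, hk⟩ : ∃ k : ℕ, G * c * ρ ^ k < 1 / 2 := by
    have := (tendsto_pow_atTop_nhds_zero_of_lt_one hρ0.le hρ1).const_mul (G * c)
    rw [mul_zero] at this
    exact (this.eventually_lt_const one_half_pos).exists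
  have hδk : 0 < δ ^ k := pow_pos hδ k
  refine ⟨k, ?_⟩
  filter_upwards [hEs, hlim.eventually_const_lt (show 1 - δ ^ k / 2 < 1 by linarith),
    eventually_ge_atTop k] with n hEn hPn hkn
  by_contra! hcon
  have hps : ∀ i, 0 ≤ p i * s n := fun i ↦ (mul_pos (h.weight_pos i) (hs n)).le
  have first : 1 / 2 ≤ ∏ i ∈ Finset.range (n + 1 - k), (1 - d i (p i * s n)) := by
    have union_bound := one_sub_sum_le_prod_one_sub (s := Finset.range (n + 1 - k))
      (fun i _ ↦ h.nonneg i (hps i)) (fun i _ ↦ h.le_one i (hps i))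
    linarith [htail n k c (s n) (hs n) hEn]
  have last : δ ^ k ≤ ∏ j ∈ Finset.range k, (1 - d (n - j) (p (n - j) * s n)) := by
    calc δ ^ k = ∏ _j ∈ Finset.range k, δ := by simp
      _ ≤ _ := Finset.prod_le_prod (fun _ _ ↦ hδ.le) fun j hj ↦ by
        have := Finset.mem_range.1 hj
        linarith [hcon (n - j) (by omega) (by omega)]
  have prod_le := h.prod_one_sub_le n (hs n).le
  rw [prod_range_succ_eq_prod_mul_prod_sub _ (by omega : k ≤ n + 1)] at prod_le
  linarith [mul_le_mul first last hδk.le (one_half_pos.le.trans first)]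

theorem isCutoffTime_subfamily (h : IsProductDist d P p) {τ δ : ℕ → ℝ} {ξ ν : ℕ → ℕ}
    (hτ : ∀ n, 0 < τ n)
    (hup : ∀ a, 1 < a → Tendsto (fun n ↦ P n (weightSum p n * (a * τ n))) atTop (𝓝 0))
    (hξ : Tendsto ξ atTop atTop) (hξν : ∀ j, ξ j ≤ ν j) (hδ : Tendsto δ atTop (𝓝 0))
    (hslow : ∀ j, 1 - δ j ≤ d (ξ j) (p (ξ j) * ((1 - δ j) * τ (ν j)))) :
    IsCutoffTime (fun j ↦ d (ξ j)) fun j ↦ p (ξ j) * τ (ν j) := by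
  have hpos : ∀ j, 0 < p (ξ j) * τ (ν j) := fun j ↦ mul_pos (h.weight_pos _) (hτ _)
  have hlim : Tendsto (fun j ↦ 1 - δ j) atTop (𝓝 1) := by simpa using hδ.const_sub 1
  refine ⟨hpos, fun a ha ↦ ?_, fun a ha0 ha1 ↦ ?_⟩
  · have a0 : 0 < a := zero_lt_one.trans ha
    refine squeeze_zero (fun j ↦ h.nonneg _ (mul_pos a0 (hpos j)).le) (fun j ↦ ?_)
      ((hup a ha).comp (tendsto_atTop_mono hξν hξ))
    rw [mul_left_comm]
    exact h.le_prod (hξν j) (mul_pos a0 (hτ _)).le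
  · refine tendsto_of_tendsto_of_tendsto_of_le_of_le' hlim tendsto_const_nhds ?_
      (.of_forall fun j ↦ h.le_one _ (mul_pos ha0 (hpos j)).le)
    filter_upwards [hlim.eventually_const_lt ha1] with j hj
    have h0 : 0 ≤ a * (p (ξ j) * τ (ν j)) := (mul_pos ha0 (hpos j)).le
    have hle : a * (p (ξ j) * τ (ν j)) ≤ p (ξ j) * ((1 - δ j) * τ (ν j)) := by
      rw [mul_left_comm _ (1 - δ j)]
      exact mul_le_mul_of_nonneg_right hj.le (hpos j).le
    exact (hslow j).trans (h.antitoneOn _ h0 (h0.trans hle) hle)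

theorem exists_subfamily_hasCutoff (h : IsProductDist d P p)
    (hT : IsTimeScale d fun n ↦ p n * E n) (hE : HasGeometricGrowth E) (hP : HasCutoff P) :
    ∃ ξ : ℕ → ℕ, StrictMono ξ ∧ HasCutoff fun n ↦ d (ξ n) := by
  obtain ⟨s, hs, hup, hlow⟩ := hP
  have hq := weightSum_pos h.weight_pos
  set τ : ℕ → ℝ := fun n ↦ s n / weightSum p n with τ_def
  have hτ : ∀ n, 0 < τ n := fun n ↦ div_pos (hs n) (hq n)
  have normalize : ∀ a n, a * s n = weightSum p n * (a * τ n) := fun a n ↦ by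
    rw [τ_def, mul_left_comm, mul_div_cancel₀ _ (hq n).ne']
  simp only [normalize] at hup hlow
  have hEτ : ∀ᶠ n in atTop, E n ≤ 2 * τ n := by
    have hpos : ∀ n, 0 < p n * (2 * τ n) := fun n ↦
      mul_pos (h.weight_pos n) (mul_pos two_pos (hτ n))
    filter_upwards [hT.eventually_le hpos (squeeze_zero (fun n ↦ h.nonneg n (hpos n).le)
      (fun n ↦ h.le_prod le_rfl (mul_pos two_pos (hτ n)).le) (hup 2 one_lt_two))] with n hn
    exact le_of_mul_le_mul_left hn (h.weight_pos n)
  obtain ⟨δ, -, hδ, hδ_lim⟩ := exists_seq_strictAnti_tendsto' (zero_lt_one' ℝ)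
  have slow : ∀ j, ∃ᶠ i in atTop, ∃ n, i ≤ n ∧ 1 - δ j ≤ d i (p i * ((1 - δ j) * τ n)) := by
    intro j
    have h1 : 0 < 1 - δ j := sub_pos.2 (hδ j).2
    have hEδ : ∀ᶠ n in atTop, E n ≤ 2 / (1 - δ j) * ((1 - δ j) * τ n) := by
      simpa only [← mul_assoc, div_mul_cancel₀ _ h1.ne'] using hEτ
    obtain ⟨k, hk⟩ := h.exists_eventually_exists_one_sub_le hT hE (fun n ↦ mul_pos h1 (hτ n))
      hEδ (hlow _ h1 (sub_lt_self _ (hδ j).1)) (hδ j).1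
    refine frequently_atTop.2 fun i₀ ↦ ?_
    obtain ⟨n, ⟨i, hin, hnik, hi⟩, hn⟩ := (hk.and (eventually_ge_atTop (i₀ + k))).exists
    exact ⟨i, by omega, n, hin, hi⟩
  obtain ⟨ξ, hξ, hgood⟩ := extraction_forall_of_frequently slow
  choose ν hξν hslow using hgood
  exact ⟨ξ, hξ, _, h.isCutoffTime_subfamily hτ hup hξ.tendsto_atTop hξν hδ_lim hslow⟩

end IsProductDist

/-! ### Kernels and their semigroups -/

section Kernels

variable {X Y : Type*} {a : X → ℝ} {k : X → Y → ℝ}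

/-- A probability distribution on a set, given by its point masses. -/
structure IsProb (a : X → ℝ) : Prop where
  nonneg : ∀ x, 0 ≤ a x
  hasSum : HasSum a 1

/-- A stochastic kernel: every row is a probability distribution. -/
def IsStoch (k : X → Y → ℝ) : Prop :=
  ∀ x, IsProb (k x)

/-- The row vector `a k`: the distribution after one step of the kernel `k` from the
distribution `a`. -/
def push (a : X → ℝ) (k : X → Y → ℝ) (y : Y) : ℝ :=
  ∑' x, a x * k x y

theorem IsProb.nonempty (ha : IsProb a) : Nonempty X := by
  by_contra! h
  exact one_ne_zero (ha.hasSum.unique hasSum_empty)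

theorem summable_mul_of_abs_le {f : X → ℝ} {C : ℝ} (ha : Summable a) (hf : ∀ x, |f x| ≤ C) :
    Summable fun x ↦ a x * f x := by
  refine Summable.of_norm_bounded (ha.abs.mul_right C) fun x ↦ ?_
  rw [Real.norm_eq_abs, abs_mul]
  exact mul_le_mul_of_nonneg_left (hf x) (abs_nonneg _)

theorem IsProb.abs_tsum_mul_le (ha : IsProb a) {f : X → ℝ} {C : ℝ} (hf : ∀ x, |f x| ≤ C) :
    |∑' x, a x * f x| ≤ C := by
  have hC : HasSum (fun x ↦ a x * C) C := by simpa using ha.hasSum.mul_right C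
  rw [← Real.norm_eq_abs]
  refine tsum_of_norm_bounded hC fun x ↦ ?_
  rw [Real.norm_eq_abs, abs_mul, abs_of_nonneg (ha.nonneg x)]
  exact mul_le_mul_of_nonneg_left (hf x) (ha.nonneg x)

theorem IsStoch.summable_uncurry (hk : IsStoch k) (ha : Summable a) :
    Summable (Function.uncurry fun x y ↦ a x * k x y) := by
  rw [← summable_abs_iff, summable_prod_of_nonneg fun _ ↦ abs_nonneg _]
  refine ⟨fun x ↦ ((hk x).hasSum.summable.mul_left (a x)).abs, ha.abs.congr fun x ↦ ?_⟩
  simp only [Function.uncurry_apply_pair, abs_mul, abs_of_nonneg ((hk x).nonneg _),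
    tsum_mul_left, (hk x).hasSum.tsum_eq, mul_one]

theorem IsStoch.summable_push (hk : IsStoch k) (ha : Summable a) (y : Y) :
    Summable fun x ↦ a x * k x y :=
  (hk.summable_uncurry ha).prod_symm.prod_factor y

theorem IsStoch.tsum_push_mul (hk : IsStoch k) (ha : Summable a) {f : Y → ℝ} {C : ℝ}
    (hf : ∀ y, |f y| ≤ C) : ∑' y, push a k y * f y = ∑' x, a x * ∑' y, k x y * f y := by
  have hs : Summable (Function.uncurry fun x y ↦ a x * k x y * f y) :=
    summable_mul_of_abs_le (f := fun q : X × Y ↦ f q.2) (hk.summable_uncurry ha) fun q ↦ hf q.2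
  simp_rw [push, ← tsum_mul_left, ← tsum_mul_right, ← mul_assoc]
  exact hs.tsum_comm

theorem IsStoch.hasSum_push (hk : IsStoch k) (ha : Summable a) :
    HasSum (push a k) (∑' x, a x) := by
  have total : ∑' y, push a k y = ∑' x, a x := by
    simpa only [mul_one, (hk _).hasSum.tsum_eq] using
      hk.tsum_push_mul ha (f := fun _ ↦ 1) (C := 1) (by simp)
  exact total ▸ (hk.summable_uncurry ha).prod_symm.prod.hasSum

theorem IsProb.push (ha : IsProb a) (hk : IsStoch k) : IsProb (push a k) where
  nonneg y := tsum_nonneg fun x ↦ mul_nonneg (ha.nonneg x) ((hk x).nonneg y)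
  hasSum := ha.hasSum.tsum_eq ▸ hk.hasSum_push ha.hasSum.summable

theorem IsProb.sum_mul {ι : Type*} {s : Finset ι} {w : ι → ℝ} {b : ι → X → ℝ}
    (hb : ∀ i, IsProb (b i)) (hw : ∀ i, 0 ≤ w i) (hw1 : ∑ i ∈ s, w i = 1) :
    IsProb fun x ↦ ∑ i ∈ s, w i * b i x where
  nonneg x := Finset.sum_nonneg fun i _ ↦ mul_nonneg (hw i) ((hb i).nonneg x)
  hasSum := by
    simpa only [mul_one, hw1] using hasSum_sum fun i (_ : i ∈ s) ↦ (hb i).hasSum.mul_left (w i)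

theorem idMat_self (x : X) : idMat x x = 1 := by simp [idMat]

theorem idMat_of_ne {x y : X} (h : x ≠ y) : idMat x y = 0 := by simp [idMat, h]

theorem tsum_idMat_mul (f : X → ℝ) (x : X) : ∑' y, idMat x y * f y = f x := by
  rw [tsum_eq_single x fun y hy ↦ by rw [idMat_of_ne hy.symm, zero_mul], idMat_self, one_mul]

theorem tsum_mul_idMat (f : X → ℝ) (y : X) : ∑' x, f x * idMat x y = f y := by
  rw [tsum_eq_single y fun x hx ↦ by rw [idMat_of_ne hx, mul_zero], idMat_self, mul_one]

theorem isStoch_idMat : IsStoch (idMat : X → X → ℝ) := fun x ↦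
  { nonneg := fun y ↦ by unfold idMat; split_ifs <;> norm_num
    hasSum := by simpa only [idMat_self] using
      hasSum_single (f := idMat x) x fun y hy ↦ idMat_of_ne hy.symm }

theorem idMat_pi {ι : Type*} [Fintype ι] {Y : ι → Type*} (x y : ∀ i, Y i) :
    idMat x y = ∏ i, idMat (x i) (y i) := by
  by_cases h : x = y
  · simp [h, idMat_self]
  · obtain ⟨i, hi⟩ := Function.ne_iff.1 h
    have vanish : ∏ i, idMat (x i) (y i) = 0 :=
      Finset.prod_eq_zero (Finset.mem_univ i) (idMat_of_ne hi)
    rw [idMat_of_ne h, vanish]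

end Kernels

section Operators

variable {X Y : Type*} {k : X → Y → ℝ}

/-- The Banach space of bounded real functions on a set, on which transition matrices act as
bounded operators. -/
abbrev Linf (X : Type*) := lp (fun _ : X ↦ ℝ) ∞

theorem Linf.abs_apply_le (f : Linf X) (x : X) : |f x| ≤ ‖f‖ :=
  lp.norm_apply_le_norm ENNReal.top_ne_zero f x

/-- A function bounded by `C` as an element of `Linf`. -/
def toLinf (f : X → ℝ) (C : ℝ) (hf : ∀ x, |f x| ≤ C) : Linf X :=
  ⟨f, memℓp_infty ⟨C, by rintro _ ⟨x, rfl⟩; exact hf x⟩⟩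

@[simp]
theorem toLinf_apply (f : X → ℝ) (C : ℝ) (hf : ∀ x, |f x| ≤ C) (x : X) :
    toLinf f C hf x = f x := rfl

/-- The operator of a stochastic kernel on bounded functions. -/
def IsStoch.op (hk : IsStoch k) : Linf Y →L[ℝ] Linf X :=
  LinearMap.mkContinuous
    { toFun := fun f ↦ toLinf (fun x ↦ ∑' y, k x y * f y) ‖f‖ fun x ↦
        (hk x).abs_tsum_mul_le (Linf.abs_apply_le f)
      map_add' := fun f g ↦ by
        ext x
        have hs (f : Linf Y) := summable_mul_of_abs_le (hk x).hasSum.summable (Linf.abs_apply_le f)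
        simpa only [toLinf_apply, lp.coeFn_add, Pi.add_apply, mul_add] using
          (hs f).tsum_add (hs g)
      map_smul' := fun c f ↦ by
        ext x
        simp only [toLinf_apply, lp.coeFn_smul, Pi.smul_apply, smul_eq_mul, RingHom.id_apply,
          mul_left_comm _ c, tsum_mul_left] }
    1 fun f ↦ by
      rw [one_mul]
      exact lp.norm_le_of_forall_le (norm_nonneg f) fun x ↦
        (hk x).abs_tsum_mul_le (Linf.abs_apply_le f)

theorem IsStoch.op_apply (hk : IsStoch k) (f : Linf Y) (x : X) :
    hk.op f x = ∑' y, k x y * f y := rfl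

/-- Composition with `g`, the operator of the deterministic kernel `x ↦ g x`. -/
def pullback (g : X → Y) : Linf Y →L[ℝ] Linf X :=
  IsStoch.op fun x ↦ isStoch_idMat (g x)

@[simp]
theorem pullback_apply (g : X → Y) (f : Linf Y) (x : X) : pullback g f x = f (g x) :=
  tsum_idMat_mul f (g x)

/-- The indicator function of a point. -/
def delta (y : X) : Linf X :=
  toLinf (fun x ↦ idMat x y) 1 fun x ↦ by unfold idMat; split_ifs <;> norm_num

@[simp]
theorem delta_apply (x y : X) : delta y x = idMat x y := rfl

end Operators

section Semigroup

variable {E F : Type*} [NormedAddCommGroup E] [NormedSpace ℝ E]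
  [NormedAddCommGroup F] [NormedSpace ℝ F]

theorem exp_add_of_commute_clm [CompleteSpace E] {S T : E →L[ℝ] E} (h : Commute S T) :
    NormedSpace.exp (S + T) = NormedSpace.exp S * NormedSpace.exp T := by
  let _ : NormedAlgebra ℚ (E →L[ℝ] E) := .restrictScalars ℚ ℝ _
  exact NormedSpace.exp_add_of_commute h

/-- The semigroup `e^{-t(1-T)}` of a bounded operator `T`. -/
def semigroup (T : E →L[ℝ] E) (t : ℝ) : E →L[ℝ] E :=
  NormedSpace.exp (t • (T - 1))

theorem semigroup_one (t : ℝ) : semigroup (1 : E →L[ℝ] E) t = 1 := by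
  rw [semigroup, sub_self, smul_zero, NormedSpace.exp_zero]

theorem semigroup_add [CompleteSpace E] (T : E →L[ℝ] E) (s t : ℝ) :
    semigroup T (s + t) = semigroup T s * semigroup T t := by
  rw [semigroup, add_smul,
    exp_add_of_commute_clm (((Commute.refl _).smul_left s).smul_right t), semigroup, semigroup]

/-- The weights of the Poisson distribution with parameter `t`, which are those of the powers of
`T` in `e^{-t(1-T)}`. -/
def poisson (t : ℝ) (m : ℕ) : ℝ :=
  Real.exp (-t) * (t ^ m / m.factorial)

theorem hasSum_poisson (t : ℝ) : HasSum (poisson t) 1 := by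
  have h := (NormedSpace.expSeries_div_hasSum_exp t).mul_left (Real.exp (-t))
  rwa [← Real.exp_eq_exp_ℝ, ← Real.exp_add, neg_add_cancel, Real.exp_zero] at h

theorem isProb_poisson {t : ℝ} (ht : 0 ≤ t) : IsProb (poisson t) where
  nonneg m := by unfold poisson; positivity
  hasSum := hasSum_poisson t

theorem exp_smul_one_clm (c : ℝ) :
    NormedSpace.exp (c • (1 : E →L[ℝ] E)) = Real.exp c • (1 : E →L[ℝ] E) := by
  rw [← Algebra.algebraMap_eq_smul_one, ← Algebra.algebraMap_eq_smul_one, Real.exp_eq_exp_ℝ,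
    NormedSpace.algebraMap_exp_comm]

theorem hasSum_semigroup [CompleteSpace E] (T : E →L[ℝ] E) (t : ℝ) :
    HasSum (fun m ↦ poisson t m • T ^ m) (semigroup T t) := by
  have factor : semigroup T t = Real.exp (-t) • NormedSpace.exp (t • T) := by
    rw [semigroup, smul_sub, sub_eq_add_neg, ← neg_smul,
      exp_add_of_commute_clm ((Commute.one_right _).smul_right _), exp_smul_one_clm,
      mul_smul_comm, mul_one]
  rw [factor]
  refine ((NormedSpace.exp_series_hasSum_exp' (𝕂 := ℝ) (t • T)).const_smul
    (Real.exp (-t))).congr_fun fun m ↦ ?_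
  rw [poisson, smul_pow, smul_smul, smul_smul, div_eq_inv_mul, mul_assoc]

theorem semigroup_intertwine [CompleteSpace E] [CompleteSpace F] {J : E →L[ℝ] F}
    {S : E →L[ℝ] E} {T : F →L[ℝ] F} (h : ∀ f, J (S f) = T (J f)) (t : ℝ) (f : E) :
    J (semigroup S t f) = semigroup T t (J f) := by
  have pow (m : ℕ) (f : E) : J ((S ^ m) f) = (T ^ m) (J f) := by
    induction m generalizing f with
    | zero => rfl
    | succ m ih => rw [pow_succ, pow_succ, mul_apply_eq_comp, mul_apply_eq_comp, ih, h]
  have hS := ((hasSum_semigroup S t).mapL (ContinuousLinearMap.apply ℝ E f)).mapL J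
  have hT := (hasSum_semigroup T t).mapL (ContinuousLinearMap.apply ℝ F (J f))
  refine hS.unique ?_
  simpa only [ContinuousLinearMap.apply_apply, smul_apply, map_smul, pow] using hT

theorem smul_sum_sub_one {ι : Type*} {s : Finset ι} {w : ι → ℝ} (hw : ∑ i ∈ s, w i = 1)
    (T : ι → E →L[ℝ] E) (t : ℝ) :
    t • (∑ i ∈ s, w i • T i - 1) = ∑ i ∈ s, (t * w i) • (T i - 1) := by
  simp only [mul_smul, ← Finset.smul_sum, smul_sub, Finset.sum_sub_distrib]
  rw [← Finset.sum_smul, hw, one_smul]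

theorem exp_sum_insert_of_commute [CompleteSpace E] {ι : Type*} [DecidableEq ι] {s : Finset ι}
    {a : ι} (ha : a ∉ s) {T : ι → E →L[ℝ] E} (hT : ∀ i j, Commute (T i) (T j)) (c : ι → ℝ) :
    NormedSpace.exp (∑ i ∈ insert a s, c i • (T i - 1)) =
      semigroup (T a) (c a) * NormedSpace.exp (∑ i ∈ s, c i • (T i - 1)) := by
  rw [Finset.sum_insert ha, semigroup]
  refine exp_add_of_commute_clm (Commute.sum_right _ _ _ fun i _ ↦ ?_)
  exact ((((hT a i).sub_left (Commute.one_left _)).sub_right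
    (Commute.sub_left (Commute.one_right _) (Commute.one_right _))).smul_left _).smul_right _

end Semigroup

section Heat

variable {X : Type*} {K : X → X → ℝ} {t : ℝ}

theorem isStoch_stepPow (hK : IsStoch K) (m : ℕ) : IsStoch (stepPow K m) := by
  induction m with
  | zero => exact isStoch_idMat
  | succ m ih => exact fun x ↦ (hK x).push ih

theorem IsStoch.op_pow_apply (hK : IsStoch K) (m : ℕ) (f : Linf X) (x : X) :
    (hK.op ^ m) f x = ∑' y, stepPow K m x y * f y := by
  induction m generalizing x with
  | zero => exact (tsum_idMat_mul f x).symm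
  | succ m ih =>
    rw [pow_succ', mul_apply_eq_comp, hK.op_apply]
    simp only [ih]
    exact ((isStoch_stepPow hK m).tsum_push_mul (hK x).hasSum.summable (Linf.abs_apply_le f)).symm

theorem heat_eq_push (K : X → X → ℝ) (t : ℝ) (x : X) :
    heat K t x = push (poisson t) fun m ↦ stepPow K m x := rfl

theorem isStoch_heat (hK : IsStoch K) (ht : 0 ≤ t) : IsStoch (heat K t) := fun x ↦
  (isProb_poisson ht).push fun m ↦ isStoch_stepPow hK m x

theorem IsStoch.semigroup_op_apply (hK : IsStoch K) (t : ℝ) (f : Linf X) (x : X) :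
    semigroup hK.op t f x = ∑' y, heat K t x y * f y := by
  have h := ((hasSum_semigroup hK.op t).mapL (ContinuousLinearMap.apply ℝ _ f)).mapL
    (lp.evalCLM ℝ (fun _ : X ↦ ℝ) ∞ x)
  rw [heat_eq_push, IsStoch.tsum_push_mul (fun m ↦ isStoch_stepPow hK m x)
    (hasSum_poisson t).summable (Linf.abs_apply_le f)]
  simp only [← hK.op_pow_apply]
  exact h.tsum_eq.symm

theorem IsStoch.semigroup_op_delta (hK : IsStoch K) (t : ℝ) (x y : X) :
    semigroup hK.op t (delta y) x = heat K t x y := by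
  rw [hK.semigroup_op_apply]
  exact tsum_mul_idMat (heat K t x) y

theorem heat_add (hK : IsStoch K) (s t : ℝ) (x : X) :
    heat K (s + t) x = push (heat K s x) (heat K t) := by
  ext y
  rw [← hK.semigroup_op_delta, semigroup_add, mul_apply_eq_comp, hK.semigroup_op_apply]
  simp only [hK.semigroup_op_delta, push]

/-- A stochastic matrix with a stationary probability. -/
structure IsStationaryChain (K : X → X → ℝ) (π : X → ℝ) : Prop where
  stoch : IsStoch K
  prob : IsProb π
  push_eq : push π K = π

theorem IsIrreducibleChain.isStationaryChain {π : X → ℝ} (h : IsIrreducibleChain K π) :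
    IsStationaryChain K π where
  stoch x := ⟨h.nonneg x, h.row_sum x⟩
  prob := ⟨h.prob_nonneg, h.prob_sum⟩
  push_eq := funext fun y ↦ (h.stationary y).tsum_eq

theorem IsStationaryChain.push_heat {π : X → ℝ} (h : IsStationaryChain K π) (t : ℝ) :
    push π (heat K t) = π := by
  have hπ : IsStoch fun _ : Unit ↦ π := fun _ ↦ h.prob
  have invariant : ∀ f, hπ.op (h.stoch.op f) = (1 : Linf Unit →L[ℝ] Linf Unit) (hπ.op f) := by
    intro f
    ext _
    have := h.stoch.tsum_push_mul h.prob.hasSum.summable (Linf.abs_apply_le f)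
    rw [h.push_eq] at this
    exact this.symm
  ext y
  have key := congrArg (· ()) (semigroup_intertwine invariant t (delta y))
  simpa [semigroup_one, hπ.op_apply, push, h.stoch.semigroup_op_delta, tsum_mul_idMat] using key

end Heat

/-! ### Product chains -/

section Tensor

variable {ι : Type*} [Fintype ι] {Y : ι → Type*}

/-- The product function `y ↦ ∏ i, f i (y i)`. -/
def tensor (f : ∀ i, Linf (Y i)) : Linf (∀ i, Y i) :=
  toLinf (fun y ↦ ∏ i, f i (y i)) (∏ i, ‖f i‖) fun y ↦ by
    rw [Finset.abs_prod]
    exact Finset.prod_le_prod (fun i _ ↦ abs_nonneg _) fun i _ ↦ Linf.abs_apply_le (f i) (y i)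

theorem tensor_apply (f : ∀ i, Linf (Y i)) (y : ∀ i, Y i) : tensor f y = ∏ i, f i (y i) := rfl

theorem tensor_delta (y : ∀ i, Y i) : tensor (fun i ↦ delta (y i)) = delta y := by
  ext x
  simp only [tensor_apply, delta_apply, idMat_pi x y]

end Tensor

section ProductKernel

variable {ι : Type*} [DecidableEq ι] {Y : ι → Type*} {K : ∀ i, Y i → Y i → ℝ}

/-- The kernel `I ⊗ ⋯ ⊗ I ⊗ K i ⊗ I ⊗ ⋯ ⊗ I`, as the law of the state `x` after a move of its `i`th
coordinate. -/
def coordKernel (K : ∀ i, Y i → Y i → ℝ) (i : ι) (x : ∀ i, Y i) : (∀ i, Y i) → ℝ :=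
  push (K i (x i)) fun z ↦ idMat (Function.update x i z)

theorem isStoch_coordKernel (hK : ∀ i, IsStoch (K i)) (i : ι) : IsStoch (coordKernel K i) :=
  fun x ↦ (hK i (x i)).push fun _ ↦ isStoch_idMat _

/-- The operator of `coordKernel K i`. -/
def coordOp (hK : ∀ i, IsStoch (K i)) (i : ι) : Linf (∀ i, Y i) →L[ℝ] Linf (∀ i, Y i) :=
  (isStoch_coordKernel hK i).op

theorem coordOp_apply (hK : ∀ i, IsStoch (K i)) (i : ι) (f : Linf (∀ i, Y i)) (x : ∀ i, Y i) :
    coordOp hK i f x = ∑' z, K i (x i) z * f (Function.update x i z) := by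
  rw [coordOp, IsStoch.op_apply, coordKernel,
    IsStoch.tsum_push_mul (fun _ ↦ isStoch_idMat _) (hK i (x i)).hasSum.summable
      (Linf.abs_apply_le f)]
  simp only [tsum_idMat_mul]

theorem commute_coordOp (hK : ∀ i, IsStoch (K i)) (i j : ι) :
    Commute (coordOp hK i) (coordOp hK j) := by
  rcases eq_or_ne i j with rfl | hij
  · exact Commute.refl _
  ext f x
  have two_moves {i j : ι} (h : i ≠ j) : coordOp hK i (coordOp hK j f) x =
      ∑' z, ∑' w, K i (x i) z * K j (x j) w * f (Function.update (Function.update x i z) j w) := by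
    simp only [coordOp_apply, Function.update_of_ne h.symm, ← tsum_mul_left, mul_assoc]
  have hs : Summable (Function.uncurry fun z w ↦
      K i (x i) z * K j (x j) w * f (Function.update (Function.update x i z) j w)) :=
    summable_mul_of_abs_le
      (f := fun q : Y i × Y j ↦ f (Function.update (Function.update x i q.1) j q.2))
      (IsStoch.summable_uncurry (k := fun _ ↦ K j (x j)) (fun _ ↦ hK j (x j))
        (hK i (x i)).hasSum.summable) fun _ ↦ Linf.abs_apply_le f _
  rw [mul_apply_eq_comp, mul_apply_eq_comp, two_moves hij, two_moves hij.symm, ← hs.tsum_comm]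
  refine tsum_congr fun w ↦ tsum_congr fun z ↦ ?_
  rw [mul_comm (K i _ _), Function.update_comm hij]

theorem semigroup_coordOp_apply (hK : ∀ i, IsStoch (K i)) (i : ι) (t : ℝ)
    (f : Linf (∀ i, Y i)) (x : ∀ i, Y i) :
    semigroup (coordOp hK i) t f x =
      semigroup (hK i).op t (pullback (Function.update x i) f) (x i) := by
  have restrict (f : Linf (∀ i, Y i)) : pullback (Function.update x i) (coordOp hK i f) =
      (hK i).op (pullback (Function.update x i) f) := by
    ext z
    simp only [pullback_apply, coordOp_apply, IsStoch.op_apply, Function.update_self,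
      Function.update_idem]
  rw [← semigroup_intertwine restrict, pullback_apply, Function.update_eq_self]

variable [Fintype ι]

theorem semigroup_coordOp_tensor (hK : ∀ i, IsStoch (K i)) (i : ι) (t : ℝ)
    (f : ∀ i, Linf (Y i)) : semigroup (coordOp hK i) t (tensor f) =
      tensor (Function.update f i (semigroup (hK i).op t (f i))) := by
  ext x
  have restrict : pullback (Function.update x i) (tensor f) =
      (∏ j ∈ Finset.univ.erase i, f j (x j)) • f i := by
    ext z
    rw [pullback_apply, tensor_apply, ← Finset.prod_erase_mul _ _ (Finset.mem_univ i),
      Function.update_self, lp.coeFn_smul, Pi.smul_apply, smul_eq_mul]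
    congr 1
    refine Finset.prod_congr rfl fun j hj ↦ ?_
    rw [Function.update_of_ne (Finset.ne_of_mem_erase hj)]
  rw [semigroup_coordOp_apply, restrict, map_smul, lp.coeFn_smul, Pi.smul_apply, smul_eq_mul,
    tensor_apply, ← Finset.prod_erase_mul _ _ (Finset.mem_univ i), Function.update_self]
  congr 1
  refine Finset.prod_congr rfl fun j hj ↦ ?_
  rw [Function.update_of_ne (Finset.ne_of_mem_erase hj)]

theorem exp_sum_coordOp_tensor (hK : ∀ i, IsStoch (K i)) (c : ι → ℝ) (f : ∀ i, Linf (Y i))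
    (s : Finset ι) : NormedSpace.exp (∑ i ∈ s, c i • (coordOp hK i - 1)) (tensor f) =
      tensor (s.piecewise (fun i ↦ semigroup (hK i).op (c i) (f i)) f) := by
  induction s using Finset.induction_on with
  | empty => simp
  | insert a s ha ih =>
    rw [exp_sum_insert_of_commute ha (commute_coordOp hK), mul_apply_eq_comp, ih,
      semigroup_coordOp_tensor, Finset.piecewise_eq_of_notMem _ _ _ ha, Finset.piecewise_insert]

theorem prodMat_eq_sum_coordKernel (w : ι → ℝ) (K : ∀ i, Y i → Y i → ℝ) (x y : ∀ i, Y i) :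
    prodMat w K x y = ∑ i, w i * coordKernel K i x y := by
  refine Finset.sum_congr rfl fun i _ ↦ ?_
  have factor (z : Y i) : idMat (Function.update x i z) y =
      idMat z (y i) * ∏ j ∈ Finset.univ.erase i, idMat (x j) (y j) := by
    rw [idMat_pi, ← Finset.mul_prod_erase _ _ (Finset.mem_univ i), Function.update_self]
    congr 1
    refine Finset.prod_congr rfl fun j hj ↦ ?_
    rw [Function.update_of_ne (Finset.ne_of_mem_erase hj)]
  simp only [coordKernel, push, factor, ← mul_assoc, tsum_mul_right, tsum_mul_idMat]

variable {w : ι → ℝ}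

theorem isStoch_prodMat (hK : ∀ i, IsStoch (K i)) (hw : ∀ i, 0 ≤ w i) (hw1 : ∑ i, w i = 1) :
    IsStoch (prodMat w K) := fun x ↦ by
  simpa only [← prodMat_eq_sum_coordKernel] using
    IsProb.sum_mul (fun i ↦ isStoch_coordKernel hK i x) hw hw1

theorem op_prodMat (hK : ∀ i, IsStoch (K i)) (hP : IsStoch (prodMat w K)) :
    hP.op = ∑ i, w i • coordOp hK i := by
  ext f x
  have hs (i : ι) : Summable fun y ↦ coordKernel K i x y * f y :=
    summable_mul_of_abs_le (isStoch_coordKernel hK i x).hasSum.summable (Linf.abs_apply_le f)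
  calc hP.op f x = ∑' y, ∑ i, w i * (coordKernel K i x y * f y) := by
        simp only [hP.op_apply, prodMat_eq_sum_coordKernel, Finset.sum_mul, mul_assoc]
    _ = ∑ i, w i * coordOp hK i f x := by
        rw [Summable.tsum_finsetSum fun i _ ↦ (hs i).mul_left (w i)]
        simp only [tsum_mul_left, coordOp, IsStoch.op_apply]
    _ = (∑ i, w i • coordOp hK i) f x := by
        simp only [sum_apply, smul_apply, lp.coeFn_sum, Finset.sum_apply, lp.coeFn_smul,
          Pi.smul_apply, smul_eq_mul]

/-- The generators of the coordinates commute, so the semigroup of the product chain factors. -/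
theorem heat_prodMat (hK : ∀ i, IsStoch (K i)) (hw : ∀ i, 0 ≤ w i) (hw1 : ∑ i, w i = 1) (t : ℝ)
    (x y : ∀ i, Y i) : heat (prodMat w K) t x y = ∏ i, heat (K i) (t * w i) (x i) (y i) := by
  have hP := isStoch_prodMat hK hw hw1
  rw [← hP.semigroup_op_delta, semigroup, op_prodMat hK, smul_sum_sub_one hw1, ← tensor_delta,
    exp_sum_coordOp_tensor, Finset.piecewise_univ, tensor_apply]
  simp only [IsStoch.semigroup_op_delta]

end ProductKernel

/-! ### Affinities and distances -/

section Affinity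

variable {X Y : Type*} {φ : ℝ → ℝ → ℝ} {a b : X → ℝ} {k : X → Y → ℝ}

/-- The functions `φ` of two nonnegative numbers for which `∑ y, φ (a y) (b y)` behaves as an
affinity of the distributions `a` and `b`: it is at most `1`, does not decrease under kernels and
is supermultiplicative on products. The examples are the minimum and the geometric mean. -/
structure IsAffinity (φ : ℝ → ℝ → ℝ) : Prop where
  nonneg : ∀ ⦃a b⦄, 0 ≤ a → 0 ≤ b → 0 ≤ φ a b
  one : φ 1 1 = 1
  superadd : ∀ ⦃a b c d⦄, 0 ≤ a → 0 ≤ b → 0 ≤ c → 0 ≤ d → φ a b + φ c d ≤ φ (a + c) (b + d)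
  homog : ∀ ⦃a b c⦄, 0 ≤ a → 0 ≤ b → 0 ≤ c → φ a b * c = φ (a * c) (b * c)
  mul_le : ∀ ⦃a b c d⦄, 0 ≤ a → 0 ≤ b → 0 ≤ c → 0 ≤ d → φ a b * φ c d ≤ φ (a * c) (b * d)

/-- The geometric mean of two nonnegative numbers. -/
def geomMean (a b : ℝ) : ℝ :=
  √a * √b

theorem isAffinity_min : IsAffinity min where
  nonneg _ _ := le_min
  one := min_self 1
  superadd _ _ _ _ _ _ _ _ := min_add_min_le_min_add_add
  homog _ _ _ _ _ hc := min_mul_of_nonneg _ _ hc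
  mul_le _ _ _ _ ha hb hc hd := le_min
    (mul_le_mul (min_le_left _ _) (min_le_left _ _) (le_min hc hd) ha)
    (mul_le_mul (min_le_right _ _) (min_le_right _ _) (le_min hc hd) hb)

theorem isAffinity_geomMean : IsAffinity geomMean where
  nonneg _ _ _ _ := mul_nonneg (Real.sqrt_nonneg _) (Real.sqrt_nonneg _)
  one := by simp [geomMean]
  superadd a b c d ha hb hc hd := by
    unfold geomMean
    rw [← Real.sqrt_mul (add_nonneg ha hc)]
    have lagrange :
        (√a * √b + √c * √d) ^ 2 + (√a * √d - √c * √b) ^ 2 = (a + c) * (b + d) := by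
      conv_rhs => rw [← Real.sq_sqrt ha, ← Real.sq_sqrt hb, ← Real.sq_sqrt hc, ← Real.sq_sqrt hd]
      ring
    exact Real.le_sqrt_of_sq_le (by linarith [sq_nonneg (√a * √d - √c * √b)])
  homog a b c ha hb hc := by
    unfold geomMean
    rw [Real.sqrt_mul ha, Real.sqrt_mul hb, mul_mul_mul_comm, Real.mul_self_sqrt hc]
  mul_le a b c d ha hb _ _ := by
    unfold geomMean
    rw [Real.sqrt_mul ha, Real.sqrt_mul hb, mul_mul_mul_comm]

theorem min_le_geomMean {a b : ℝ} (ha : 0 ≤ a) (hb : 0 ≤ b) : min a b ≤ geomMean a b := by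
  rw [← Real.mul_self_sqrt (le_min ha hb), geomMean]
  gcongr
  exacts [min_le_left _ _, min_le_right _ _]

theorem geomMean_min_max (a b : ℝ) : geomMean (min a b) (max a b) = geomMean a b := by
  rcases le_total a b with h | h
  · rw [min_eq_left h, max_eq_right h]
  · rw [min_eq_right h, max_eq_left h, geomMean, geomMean, mul_comm]

/-- The affinity of two distributions given by the function `φ`. -/
def aff (φ : ℝ → ℝ → ℝ) (a b : X → ℝ) : ℝ :=
  ∑' x, φ (a x) (b x)

namespace IsAffinity

theorem mono (h : IsAffinity φ) {a b c d : ℝ} (ha : 0 ≤ a) (hb : 0 ≤ b) (hac : a ≤ c)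
    (hbd : b ≤ d) : φ a b ≤ φ c d := by
  have hs := h.superadd ha hb (sub_nonneg.2 hac) (sub_nonneg.2 hbd)
  rw [add_sub_cancel, add_sub_cancel] at hs
  exact (le_add_of_nonneg_right (h.nonneg (sub_nonneg.2 hac) (sub_nonneg.2 hbd))).trans hs

theorem le_add (h : IsAffinity φ) {a b : ℝ} (ha : 0 ≤ a) (hb : 0 ≤ b) : φ a b ≤ a + b := by
  calc φ a b ≤ φ (a + b) (a + b) := h.mono ha hb (by linarith) (by linarith)
    _ = φ 1 1 * (a + b) := by
      rw [h.homog zero_le_one zero_le_one (add_nonneg ha hb), one_mul]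
    _ = a + b := by rw [h.one, one_mul]

theorem sum_le (h : IsAffinity φ) (ha : ∀ x, 0 ≤ a x) (hb : ∀ x, 0 ≤ b x) (s : Finset X) :
    ∑ x ∈ s, φ (a x) (b x) ≤ φ (∑ x ∈ s, a x) (∑ x ∈ s, b x) := by
  induction s using Finset.cons_induction with
  | empty => simpa using h.nonneg le_rfl le_rfl
  | cons x s hx ih =>
    rw [Finset.sum_cons, Finset.sum_cons, Finset.sum_cons]
    exact (add_le_add_right ih _).trans (h.superadd (ha x) (hb x)
      (Finset.sum_nonneg fun i _ ↦ ha i) (Finset.sum_nonneg fun i _ ↦ hb i))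

theorem prod_le (h : IsAffinity φ) (ha : ∀ x, 0 ≤ a x) (hb : ∀ x, 0 ≤ b x) (s : Finset X) :
    ∏ x ∈ s, φ (a x) (b x) ≤ φ (∏ x ∈ s, a x) (∏ x ∈ s, b x) := by
  induction s using Finset.cons_induction with
  | empty => simp [h.one]
  | cons x s hx ih =>
    rw [Finset.prod_cons, Finset.prod_cons, Finset.prod_cons]
    exact (mul_le_mul_of_nonneg_left ih (h.nonneg (ha x) (hb x))).trans (h.mul_le (ha x) (hb x)
      (Finset.prod_nonneg fun i _ ↦ ha i) (Finset.prod_nonneg fun i _ ↦ hb i))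

theorem summable (h : IsAffinity φ) (ha : ∀ x, 0 ≤ a x) (hb : ∀ x, 0 ≤ b x)
    (has : Summable a) (hbs : Summable b) : Summable fun x ↦ φ (a x) (b x) :=
  .of_nonneg_of_le (fun x ↦ h.nonneg (ha x) (hb x)) (fun x ↦ h.le_add (ha x) (hb x))
    (has.add hbs)

theorem tsum_le (h : IsAffinity φ) (ha : ∀ x, 0 ≤ a x) (hb : ∀ x, 0 ≤ b x)
    (has : Summable a) (hbs : Summable b) :
    ∑' x, φ (a x) (b x) ≤ φ (∑' x, a x) (∑' x, b x) :=
  Real.tsum_le_of_sum_le (fun x ↦ h.nonneg (ha x) (hb x)) fun s ↦ (h.sum_le ha hb s).trans <|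
    h.mono (Finset.sum_nonneg fun i _ ↦ ha i) (Finset.sum_nonneg fun i _ ↦ hb i)
      (has.sum_le_tsum _ fun i _ ↦ ha i) (hbs.sum_le_tsum _ fun i _ ↦ hb i)

theorem summable_of_isProb (h : IsAffinity φ) (ha : IsProb a) (hb : IsProb b) :
    Summable fun x ↦ φ (a x) (b x) :=
  h.summable ha.nonneg hb.nonneg ha.hasSum.summable hb.hasSum.summable

theorem aff_nonneg (h : IsAffinity φ) (ha : IsProb a) (hb : IsProb b) : 0 ≤ aff φ a b :=
  tsum_nonneg fun x ↦ h.nonneg (ha.nonneg x) (hb.nonneg x)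

theorem aff_le_one (h : IsAffinity φ) (ha : IsProb a) (hb : IsProb b) : aff φ a b ≤ 1 := by
  have := h.tsum_le ha.nonneg hb.nonneg ha.hasSum.summable hb.hasSum.summable
  rwa [ha.hasSum.tsum_eq, hb.hasSum.tsum_eq, h.one] at this

theorem aff_le_aff_push (h : IsAffinity φ) (ha : IsProb a) (hb : IsProb b) (hk : IsStoch k) :
    aff φ a b ≤ aff φ (push a k) (push b k) := by
  have mass := hk.hasSum_push (h.summable_of_isProb ha hb)
  rw [aff, ← mass.tsum_eq]
  refine mass.summable.tsum_le_tsum (fun y ↦ ?_) (h.summable_of_isProb (ha.push hk) (hb.push hk))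
  rw [push, tsum_congr fun x ↦ h.homog (ha.nonneg x) (hb.nonneg x) ((hk x).nonneg y)]
  exact h.tsum_le (fun x ↦ mul_nonneg (ha.nonneg x) ((hk x).nonneg y))
    (fun x ↦ mul_nonneg (hb.nonneg x) ((hk x).nonneg y))
    (hk.summable_push ha.hasSum.summable y) (hk.summable_push hb.hasSum.summable y)

end IsAffinity

theorem aff_min_le_aff_geomMean (ha : IsProb a) (hb : IsProb b) :
    aff min a b ≤ aff geomMean a b :=
  (isAffinity_min.summable_of_isProb ha hb).tsum_le_tsum
    (fun x ↦ min_le_geomMean (ha.nonneg x) (hb.nonneg x))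
    (isAffinity_geomMean.summable_of_isProb ha hb)

theorem one_sub_aff_min_sq_le (ha : IsProb a) (hb : IsProb b) :
    (1 - aff min a b) ^ 2 ≤ 2 * (1 - aff geomMean a b) := by
  have hmin := (isAffinity_min.summable_of_isProb ha hb).hasSum
  have hmax : HasSum (fun x ↦ max (a x) (b x)) (1 + 1 - aff min a b) :=
    ((ha.hasSum.add hb.hasSum).sub hmin).congr_fun fun x ↦
      eq_sub_of_add_eq' (min_add_max (a x) (b x))
  have cauchy_schwarz : aff geomMean a b ≤ geomMean (aff min a b) (1 + 1 - aff min a b) := by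
    have := isAffinity_geomMean.tsum_le (fun x ↦ le_min (ha.nonneg x) (hb.nonneg x))
      (fun x ↦ le_max_of_le_left (ha.nonneg x)) hmin.summable hmax.summable
    simp only [geomMean_min_max, hmax.tsum_eq] at this
    exact this
  have sq_le := pow_le_pow_left₀ (isAffinity_geomMean.aff_nonneg ha hb) cauchy_schwarz 2
  rw [geomMean, mul_pow, Real.sq_sqrt (isAffinity_min.aff_nonneg ha hb),
    Real.sq_sqrt (by linarith [isAffinity_min.aff_le_one ha hb])] at sq_le
  linarith [sq_nonneg (1 - aff geomMean a b)]

theorem hasSum_sq_sqrt_sub_sqrt (ha : IsProb a) (hb : IsProb b) :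
    HasSum (fun x ↦ (√(a x) - √(b x)) ^ 2) (2 * (1 - aff geomMean a b)) := by
  rw [show 2 * (1 - aff geomMean a b) = 1 + 1 - 2 * aff geomMean a b by ring]
  refine ((ha.hasSum.add hb.hasSum).sub
    ((isAffinity_geomMean.summable_of_isProb ha hb).hasSum.mul_left 2)).congr_fun fun x ↦ ?_
  rw [geomMean]
  linarith [Real.sq_sqrt (ha.nonneg x), Real.sq_sqrt (hb.nonneg x)]

end Affinity

section TotalVariation

variable {X Y : Type*} {a b f : X → ℝ} {C : ℝ}

theorem IsProb.hasSum_sub_min (ha : IsProb a) (hb : IsProb b) :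
    HasSum (fun x ↦ a x - min (a x) (b x)) (1 - aff min a b) :=
  ha.hasSum.sub (isAffinity_min.summable_of_isProb ha hb).hasSum

theorem aff_min_comm (a b : X → ℝ) : aff min a b = aff min b a := by
  simp only [aff, min_comm]

theorem IsProb.hasSum_abs_sub (ha : IsProb a) (hb : IsProb b) :
    HasSum (fun x ↦ |a x - b x|) (2 * (1 - aff min a b)) := by
  have h := (ha.hasSum_sub_min hb).add (hb.hasSum_sub_min ha)
  rw [aff_min_comm b a, ← two_mul] at h
  refine h.congr_fun fun x ↦ ?_
  rw [← max_sub_min_eq_abs', min_comm (b x)]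
  linarith [min_add_max (a x) (b x)]

theorem IsProb.hasSum_sub_mul (ha : IsProb a) (hb : IsProb b) (hf : ∀ x, |f x| ≤ C) :
    HasSum (fun x ↦ (a x - b x) * f x) (∑' x, a x * f x - ∑' x, b x * f x) := by
  simpa only [sub_mul] using (summable_mul_of_abs_le ha.hasSum.summable hf).hasSum.sub
    (summable_mul_of_abs_le hb.hasSum.summable hf).hasSum

theorem IsProb.abs_tsum_mul_sub_le (ha : IsProb a) (hb : IsProb b) (hf : ∀ x, |f x| ≤ C) :
    |∑' x, a x * f x - ∑' x, b x * f x| ≤ 2 * (1 - aff min a b) * C := by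
  rw [← (ha.hasSum_sub_mul hb hf).tsum_eq, ← Real.norm_eq_abs]
  refine tsum_of_norm_bounded ((ha.hasSum_abs_sub hb).mul_right C) fun x ↦ ?_
  rw [Real.norm_eq_abs, abs_mul]
  exact mul_le_mul_of_nonneg_left (hf x) (abs_nonneg _)

/-- Test `push a k - push b k` against its sign `f`: the average of `f` under each row of `k` is
within `2 * r` of its average under `c`, and `a - b` annihilates constants. -/
theorem one_sub_aff_min_push_le {c : Y → ℝ} {k : X → Y → ℝ} {r : ℝ} (ha : IsProb a)
    (hb : IsProb b) (hk : IsStoch k) (hc : IsProb c) (hr : ∀ x, 1 - aff min (k x) c ≤ r) :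
    1 - aff min (push a k) (push b k) ≤ 2 * (1 - aff min a b) * r := by
  set f : Y → ℝ := fun y ↦ SignType.sign (push a k y - push b k y)
  have hf : ∀ y, |f y| ≤ 1 := fun y ↦ by
    rcases lt_trichotomy (push a k y - push b k y) 0 with h | h | h <;> simp [f, h]
  set F : X → ℝ := fun x ↦ ∑' y, k x y * f y
  set γ := ∑' y, c y * f y
  have hF : ∀ x, |F x| ≤ 1 := fun x ↦ (hk x).abs_tsum_mul_le hf
  have hFγ : ∀ x, |F x - γ| ≤ 2 * r := fun x ↦
    ((hk x).abs_tsum_mul_sub_le hc hf).trans (by linarith [hr x])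
  have center : ∀ {a : X → ℝ}, IsProb a → ∑' x, a x * (F x - γ) = ∑' x, a x * F x - γ :=
    fun {a} ha ↦ by
      simp only [mul_sub]
      rw [(summable_mul_of_abs_le ha.hasSum.summable hF).tsum_sub
        (ha.hasSum.summable.mul_right γ), tsum_mul_right, ha.hasSum.tsum_eq, one_mul]
  have push_eq : 2 * (1 - aff min (push a k) (push b k)) =
      ∑' x, a x * (F x - γ) - ∑' x, b x * (F x - γ) := by
    rw [← ((ha.push hk).hasSum_abs_sub (hb.push hk)).tsum_eq, center ha, center hb,
      sub_sub_sub_cancel_right, ← hk.tsum_push_mul ha.hasSum.summable hf,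
      ← hk.tsum_push_mul hb.hasSum.summable hf,
      ← ((ha.push hk).hasSum_sub_mul (hb.push hk) hf).tsum_eq]
    exact tsum_congr fun y ↦ (self_mul_sign _).symm
  have bound := (le_abs_self _).trans (ha.abs_tsum_mul_sub_le hb hFγ)
  rw [← push_eq] at bound
  linarith

theorem IsProb.tsum_subtype_sub_eq (ha : IsProb a) (hb : IsProb b) (S : Set X) :
    ∑' x : S, a x - ∑' x : S, b x = ∑' x : S, (a x - b x) :=
  ((ha.hasSum.summable.subtype S).tsum_sub (hb.hasSum.summable.subtype S)).symm

theorem IsProb.tsum_subtype_sub_le (ha : IsProb a) (hb : IsProb b) (S : Set X) :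
    ∑' x : S, a x - ∑' x : S, b x ≤ 1 - aff min a b := by
  have h := ha.hasSum_sub_min hb
  rw [ha.tsum_subtype_sub_eq hb, ← h.tsum_eq]
  calc ∑' x : S, (a x - b x) ≤ ∑' x : S, (a x - min (a x) (b x)) :=
        ((ha.hasSum.summable.sub hb.hasSum.summable).subtype S).tsum_le_tsum
          (fun x ↦ sub_le_sub_left (min_le_right _ _) _) (h.summable.subtype S)
    _ ≤ ∑' x, (a x - min (a x) (b x)) :=
        h.summable.tsum_subtype_le _ S fun x ↦ sub_nonneg.2 (min_le_left _ _)

theorem IsProb.exists_tsum_subtype_sub_eq (ha : IsProb a) (hb : IsProb b) :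
    ∃ S : Set X, ∑' x : S, a x - ∑' x : S, b x = 1 - aff min a b := by
  refine ⟨{x | b x ≤ a x}, ?_⟩
  rw [ha.tsum_subtype_sub_eq hb, ← (ha.hasSum_sub_min hb).tsum_eq,
    ← tsum_subtype_eq_of_support_subset (s := {x | b x ≤ a x}) fun x hx ↦ ?_]
  · exact tsum_congr fun x ↦ by rw [min_eq_right x.2]
  · exact le_of_not_ge fun h : a x ≤ b x ↦ hx (by simp [h])

end TotalVariation

section PiDistribution

variable {ι : Type*} [Fintype ι] {Y : ι → Type*} {φ : ℝ → ℝ → ℝ} {a b : ∀ i, Y i → ℝ}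

theorem hasSum_pi_prod {f : ∀ i, Y i → ℝ} {s : ι → ℝ} (h0 : ∀ i y, 0 ≤ f i y)
    (hf : ∀ i, HasSum (f i) (s i)) :
    HasSum (fun y : ∀ i, Y i ↦ ∏ i, f i (y i)) (∏ i, s i) := by
  classical
  have rectangle (S : ∀ i, Finset (Y i)) :
      ∑ y ∈ Fintype.piFinset S, ∏ i, f i (y i) = ∏ i, ∑ y ∈ S i, f i y :=
    (Finset.prod_univ_sum S f).symm
  have summable : Summable fun y : ∀ i, Y i ↦ ∏ i, f i (y i) := by
    refine summable_of_sum_le (c := ∏ i, s i)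
      (fun y ↦ Finset.prod_nonneg fun i _ ↦ h0 i (y i)) fun u ↦ ?_
    let S : ∀ i, Finset (Y i) := fun i ↦ u.image fun y ↦ y i
    calc ∑ y ∈ u, ∏ i, f i (y i) ≤ ∑ y ∈ Fintype.piFinset S, ∏ i, f i (y i) :=
          Finset.sum_le_sum_of_subset_of_nonneg
            (fun y hy ↦ Fintype.mem_piFinset.2 fun i ↦ Finset.mem_image_of_mem _ hy)
            fun y _ _ ↦ Finset.prod_nonneg fun i _ ↦ h0 i (y i)
      _ = ∏ i, ∑ y ∈ S i, f i y := rectangle S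
      _ ≤ ∏ i, s i := Finset.prod_le_prod (fun i _ ↦ Finset.sum_nonneg fun y _ ↦ h0 i y)
          fun i _ ↦ sum_le_hasSum _ (fun y _ ↦ h0 i y) (hf i)
  have exhaust : Tendsto (fun S : ∀ i, Finset (Y i) ↦ Fintype.piFinset S) atTop atTop :=
    tendsto_atTop_finset_of_monotone (fun _ _ h ↦ Fintype.piFinset_subset _ _ h) fun y ↦
      ⟨fun i ↦ {y i}, by simp⟩
  have eval (i : ι) : Tendsto (fun S : ∀ i, Finset (Y i) ↦ S i) atTop atTop :=
    tendsto_atTop_atTop_of_monotone (Function.monotone_eval i) fun S ↦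
      ⟨Function.update ⊥ i S, by simp⟩
  have factors : Tendsto (fun S : ∀ i, Finset (Y i) ↦ ∏ i, ∑ y ∈ S i, f i y) atTop
      (𝓝 (∏ i, s i)) := tendsto_finsetProd _ fun i _ ↦ (hf i).comp (eval i)
  have total := (summable.hasSum.comp exhaust).congr rectangle
  exact tendsto_nhds_unique total factors ▸ summable.hasSum

theorem isProb_pi (ha : ∀ i, IsProb (a i)) : IsProb fun y : ∀ i, Y i ↦ ∏ i, a i (y i) where
  nonneg y := Finset.prod_nonneg fun i _ ↦ (ha i).nonneg _
  hasSum := by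
    simpa using hasSum_pi_prod (fun i ↦ (ha i).nonneg) (fun i ↦ (ha i).hasSum)

theorem IsAffinity.prod_aff_le (h : IsAffinity φ) (ha : ∀ i, IsProb (a i))
    (hb : ∀ i, IsProb (b i)) :
    ∏ i, aff φ (a i) (b i) ≤
      aff φ (fun y : ∀ i, Y i ↦ ∏ i, a i (y i)) (fun y ↦ ∏ i, b i (y i)) := by
  have product := hasSum_pi_prod (f := fun i y ↦ φ (a i y) (b i y))
    (fun i y ↦ h.nonneg ((ha i).nonneg y) ((hb i).nonneg y))
    fun i ↦ (h.summable_of_isProb (ha i) (hb i)).hasSum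
  exact product.tsum_eq.ge.trans <| product.summable.tsum_le_tsum
    (fun y ↦ h.prod_le (fun i ↦ (ha i).nonneg _) (fun i ↦ (hb i).nonneg _) _)
    (h.summable_of_isProb (isProb_pi ha) (isProb_pi hb))

theorem push_pi_eval (ha : ∀ i, IsProb (a i)) (i : ι) :
    push (fun y : ∀ i, Y i ↦ ∏ j, a j (y j)) (fun y ↦ idMat (y i)) = a i := by
  classical
  ext z
  let f : ∀ j, Y j → ℝ := Function.update a i fun y ↦ a i y * idMat y z
  have hf : ∀ j, (∀ y, 0 ≤ f j y) ∧ HasSum (f j) (Function.update (1 : ι → ℝ) i (a i z) j) := by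
    intro j
    rcases eq_or_ne j i with rfl | hj
    · simp only [f, Function.update_self]
      refine ⟨fun y ↦ mul_nonneg ((ha j).nonneg y) ((isStoch_idMat y).nonneg z), ?_⟩
      simpa only [idMat_self, mul_one] using
        hasSum_single (f := fun y ↦ a j y * idMat y z) z fun y hy ↦ by rw [idMat_of_ne hy, mul_zero]
    · simpa [f, hj] using ⟨(ha j).nonneg, (ha j).hasSum⟩
  have marginal := hasSum_pi_prod (fun j ↦ (hf j).1) (fun j ↦ (hf j).2)
  rw [Finset.prod_update_of_mem (Finset.mem_univ i)] at marginal
  simp only [Pi.one_apply, Finset.prod_const_one, mul_one] at marginal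
  rw [← marginal.tsum_eq]
  refine tsum_congr fun y ↦ ?_
  change (∏ j, a j (y j)) * idMat (y i) z = ∏ j, f j (y j)
  rw [← Finset.mul_prod_erase _ (fun j ↦ a j (y j)) (Finset.mem_univ i),
    ← Finset.mul_prod_erase _ (fun j ↦ f j (y j)) (Finset.mem_univ i), mul_right_comm]
  congr 1
  · simp [f]
  · exact Finset.prod_congr rfl fun j hj ↦ by simp [f, Finset.ne_of_mem_erase hj]

theorem IsAffinity.aff_pi_le (h : IsAffinity φ) (ha : ∀ i, IsProb (a i))
    (hb : ∀ i, IsProb (b i)) (i : ι) :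
    aff φ (fun y : ∀ i, Y i ↦ ∏ i, a i (y i)) (fun y ↦ ∏ i, b i (y i)) ≤
      aff φ (a i) (b i) := by
  simpa only [push_pi_eval ha, push_pi_eval hb] using
    h.aff_le_aff_push (isProb_pi ha) (isProb_pi hb) fun y : ∀ i, Y i ↦ isStoch_idMat (y i)

end PiDistribution

section Distances

variable {X : Type*} {K : X → X → ℝ} {π : X → ℝ} {φ : ℝ → ℝ → ℝ} {s t : ℝ}

/-- The maximum over the starting points of one minus the affinity with the stationary
distribution. It is the total variation for the minimum and the square of the Hellinger distance
for the geometric mean. -/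
def affDist (φ : ℝ → ℝ → ℝ) (K : X → X → ℝ) (π : X → ℝ) (t : ℝ) : ℝ :=
  ⨆ x, (1 - aff φ (heat K t x) π)

theorem one_sub_aff_heat_mem (hφ : IsAffinity φ) (hK : IsStoch K) (hπ : IsProb π) (ht : 0 ≤ t)
    (x : X) : 1 - aff φ (heat K t x) π ∈ Set.Icc 0 1 :=
  ⟨sub_nonneg.2 (hφ.aff_le_one (isStoch_heat hK ht x) hπ),
    sub_le_self _ (hφ.aff_nonneg (isStoch_heat hK ht x) hπ)⟩

theorem bddAbove_one_sub_aff_heat (hφ : IsAffinity φ) (hK : IsStoch K) (hπ : IsProb π)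
    (ht : 0 ≤ t) : BddAbove (Set.range fun x ↦ 1 - aff φ (heat K t x) π) :=
  ⟨1, by rintro _ ⟨x, rfl⟩; exact (one_sub_aff_heat_mem hφ hK hπ ht x).2⟩

theorem le_affDist (hφ : IsAffinity φ) (hK : IsStoch K) (hπ : IsProb π) (ht : 0 ≤ t) (x : X) :
    1 - aff φ (heat K t x) π ≤ affDist φ K π t :=
  le_ciSup (bddAbove_one_sub_aff_heat hφ hK hπ ht) x

theorem affDist_le (hπ : IsProb π) {c : ℝ} (h : ∀ x, 1 - aff φ (heat K t x) π ≤ c) :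
    affDist φ K π t ≤ c :=
  have := hπ.nonempty
  ciSup_le h

theorem affDist_nonneg (hφ : IsAffinity φ) (hK : IsStoch K) (hπ : IsProb π) (ht : 0 ≤ t) :
    0 ≤ affDist φ K π t :=
  Real.iSup_nonneg fun x ↦ (one_sub_aff_heat_mem hφ hK hπ ht x).1

theorem affDist_le_one (hφ : IsAffinity φ) (hK : IsStoch K) (hπ : IsProb π) (ht : 0 ≤ t) :
    affDist φ K π t ≤ 1 :=
  affDist_le hπ fun x ↦ (one_sub_aff_heat_mem hφ hK hπ ht x).2

theorem antitoneOn_affDist (hφ : IsAffinity φ) (h : IsStationaryChain K π) :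
    AntitoneOn (affDist φ K π) (Set.Ici 0) := by
  intro s hs t _ hst
  refine affDist_le h.prob fun x ↦ le_trans ?_ (le_affDist hφ h.stoch h.prob hs x)
  have le_push := hφ.aff_le_aff_push (isStoch_heat h.stoch hs x) h.prob
    (isStoch_heat h.stoch (sub_nonneg.2 hst))
  rw [h.push_heat, ← heat_add h.stoch, add_sub_cancel] at le_push
  exact sub_le_sub_left le_push 1

theorem dTV_eq_affDist (hK : IsStoch K) (hπ : IsProb π) (ht : 0 ≤ t) :
    dTV K π t = affDist min K π t := by
  have := hπ.nonempty
  have le_aff (q : X × Set X) := (isStoch_heat hK ht q.1).tsum_subtype_sub_le hπ q.2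
  refine le_antisymm
    (ciSup_le fun q ↦ (le_aff q).trans (le_affDist isAffinity_min hK hπ ht q.1))
    (affDist_le hπ fun x ↦ ?_)
  obtain ⟨S, hS⟩ := (isStoch_heat hK ht x).exists_tsum_subtype_sub_eq hπ
  rw [← hS]
  refine le_ciSup (f := fun q : X × Set X ↦ ∑' y : q.2, heat K t q.1 y - ∑' y : q.2, π y)
    ⟨1, ?_⟩ (x, S)
  rintro _ ⟨q, rfl⟩
  exact (le_aff q).trans (one_sub_aff_heat_mem isAffinity_min hK hπ ht q.1).2

theorem dH_eq_sqrt_affDist (hK : IsStoch K) (hπ : IsProb π) (ht : 0 ≤ t) :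
    dH K π t = √(affDist geomMean K π t) := by
  have := hπ.nonempty
  rw [affDist, Real.sqrt_monotone.map_ciSup_of_continuousAt Real.continuous_sqrt.continuousAt
    (bddAbove_one_sub_aff_heat isAffinity_geomMean hK hπ ht), dH]
  simp only [(hasSum_sq_sqrt_sub_sqrt (isStoch_heat hK ht _) hπ).tsum_eq, one_div,
    inv_mul_cancel_left₀ (two_ne_zero' ℝ)]

theorem dH_le_sqrt_dTV (hK : IsStoch K) (hπ : IsProb π) (ht : 0 ≤ t) :
    dH K π t ≤ √(dTV K π t) := by
  rw [dH_eq_sqrt_affDist hK hπ ht, dTV_eq_affDist hK hπ ht]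
  refine Real.sqrt_le_sqrt (affDist_le hπ fun x ↦ ?_)
  exact (sub_le_sub_left (aff_min_le_aff_geomMean (isStoch_heat hK ht x) hπ) 1).trans
    (le_affDist isAffinity_min hK hπ ht x)

theorem dTV_le_sqrt_two_mul_dH (hK : IsStoch K) (hπ : IsProb π) (ht : 0 ≤ t) :
    dTV K π t ≤ √2 * dH K π t := by
  rw [dH_eq_sqrt_affDist hK hπ ht, dTV_eq_affDist hK hπ ht, ← Real.sqrt_mul zero_le_two]
  refine affDist_le hπ fun x ↦ Real.le_sqrt_of_sq_le ?_
  linarith [one_sub_aff_min_sq_le (isStoch_heat hK ht x) hπ,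
    le_affDist isAffinity_geomMean hK hπ ht x]

theorem dTV_add_le (h : IsStationaryChain K π) (hs : 0 ≤ s) (ht : 0 ≤ t) :
    dTV K π (s + t) ≤ 2 * dTV K π s * dTV K π t := by
  rw [dTV_eq_affDist h.stoch h.prob hs, dTV_eq_affDist h.stoch h.prob ht,
    dTV_eq_affDist h.stoch h.prob (add_nonneg hs ht)]
  refine affDist_le h.prob fun x ↦ ?_
  have contraction := one_sub_aff_min_push_le (isStoch_heat h.stoch hs x) h.prob
    (isStoch_heat h.stoch ht) h.prob (le_affDist isAffinity_min h.stoch h.prob ht)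
  rw [h.push_heat, ← heat_add h.stoch] at contraction
  refine contraction.trans ?_
  gcongr
  · exact affDist_nonneg isAffinity_min h.stoch h.prob ht
  · exact le_affDist isAffinity_min h.stoch h.prob hs x

theorem dTV_nonneg (hK : IsStoch K) (hπ : IsProb π) (ht : 0 ≤ t) : 0 ≤ dTV K π t :=
  dTV_eq_affDist hK hπ ht ▸ affDist_nonneg isAffinity_min hK hπ ht

theorem dTV_nat_mul_le (h : IsStationaryChain K π) (hs : 0 ≤ s) (m : ℕ) :
    dTV K π (m * s) ≤ (2 * dTV K π s) ^ m := by
  have h0 := dTV_nonneg h.stoch h.prob hs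
  induction m with
  | zero =>
    rw [Nat.cast_zero, zero_mul, pow_zero, dTV_eq_affDist h.stoch h.prob le_rfl]
    exact affDist_le_one isAffinity_min h.stoch h.prob le_rfl
  | succ m ih =>
    calc dTV K π ((m + 1 : ℕ) * s) = dTV K π (m * s + s) := by push_cast; ring_nf
      _ ≤ 2 * dTV K π (m * s) * dTV K π s :=
          dTV_add_le h (mul_nonneg m.cast_nonneg hs) hs
      _ = dTV K π (m * s) * (2 * dTV K π s) := by ring
      _ ≤ (2 * dTV K π s) ^ (m + 1) := by rw [pow_succ]; gcongr

theorem dH_nat_mul_le (h : IsStationaryChain K π) (hs : 0 ≤ s) (m : ℕ) :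
    dH K π (m * s) ≤ √(2 * √2 * dH K π s) ^ m := by
  have hms : 0 ≤ m * s := mul_nonneg m.cast_nonneg hs
  have hTV0 := dTV_nonneg h.stoch h.prob hs
  have hTV := dTV_le_sqrt_two_mul_dH h.stoch h.prob hs
  have base0 : 0 ≤ 2 * √2 * dH K π s := by linarith
  calc dH K π (m * s) ≤ √(dTV K π (m * s)) := dH_le_sqrt_dTV h.stoch h.prob hms
    _ ≤ √((2 * dTV K π s) ^ m) := Real.sqrt_le_sqrt (dTV_nat_mul_le h hs m)
    _ ≤ √((2 * √2 * dH K π s) ^ m) :=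
      Real.sqrt_le_sqrt (pow_le_pow_left₀ (by linarith) (by linarith) m)
    _ = √(2 * √2 * dH K π s) ^ m := by
      rw [Real.sqrt_eq_iff_mul_self_eq (pow_nonneg base0 m) (by positivity), ← mul_pow,
        Real.mul_self_sqrt base0]

end Distances

section ProductDistance

variable {X : ℕ → Type*} {K : ∀ n, X n → X n → ℝ} {π : ∀ n, X n → ℝ} {p : ℕ → ℝ}
  {φ : ℝ → ℝ → ℝ} {t : ℝ}

theorem sum_div_weightSum (hp : ∀ n, 0 < p n) (n : ℕ) :
    ∑ i : Fin (n + 1), p i / weightSum p n = 1 := by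
  rw [← Finset.sum_div, Fin.sum_univ_eq_sum_range p]
  exact div_self (weightSum_pos hp n).ne'

theorem div_weightSum_nonneg (hp : ∀ n, 0 < p n) (n i : ℕ) : 0 ≤ p i / weightSum p n :=
  (div_pos (hp i) (weightSum_pos hp n)).le

theorem isStoch_productK (hK : ∀ n, IsStoch (K n)) (hp : ∀ n, 0 < p n) (n : ℕ) :
    IsStoch (productK K p n) :=
  isStoch_prodMat (fun i : Fin (n + 1) ↦ hK i) (fun i ↦ div_weightSum_nonneg hp n i)
    (sum_div_weightSum hp n)

theorem isProb_productPi (hπ : ∀ n, IsProb (π n)) (n : ℕ) : IsProb (productPi π n) :=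
  isProb_pi fun i : Fin (n + 1) ↦ hπ i

theorem heat_productK (hK : ∀ n, IsStoch (K n)) (hp : ∀ n, 0 < p n) (n : ℕ) (t : ℝ)
    (x : ∀ i : Fin (n + 1), X i) : heat (productK K p n) (weightSum p n * t) x =
      fun y ↦ ∏ i : Fin (n + 1), heat (K i) (p i * t) (x i) (y i) := by
  ext y
  refine (heat_prodMat (fun i : Fin (n + 1) ↦ hK i) (fun i ↦ div_weightSum_nonneg hp n i)
    (sum_div_weightSum hp n) _ x y).trans (Finset.prod_congr rfl fun i _ ↦ ?_)
  rw [mul_right_comm, mul_div_cancel₀ _ (weightSum_pos hp n).ne']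

theorem affDist_le_affDist_productK (hφ : IsAffinity φ) (hK : ∀ n, IsStoch (K n))
    (hπ : ∀ n, IsProb (π n)) (hp : ∀ n, 0 < p n) {i n : ℕ} (hi : i ≤ n) (ht : 0 ≤ t) :
    affDist φ (K i) (π i) (p i * t) ≤
      affDist φ (productK K p n) (productPi π n) (weightSum p n * t) := by
  classical
  refine affDist_le (hπ i) fun z ↦ ?_
  let i' : Fin (n + 1) := ⟨i, Nat.lt_succ_of_le hi⟩
  let x : ∀ j : Fin (n + 1), X j := Function.update (fun j ↦ (hπ j).nonempty.some) i' z
  have marginal := hφ.aff_pi_le (fun j : Fin (n + 1) ↦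
    isStoch_heat (hK j) (mul_nonneg (hp j).le ht) (x j)) (fun j : Fin (n + 1) ↦ hπ j) i'
  rw [← heat_productK hK hp, show x i' = z from Function.update_self ..] at marginal
  exact (sub_le_sub_left marginal 1).trans (le_affDist hφ (isStoch_productK hK hp n)
    (isProb_productPi hπ n) (mul_nonneg (weightSum_pos hp n).le ht) x)

theorem prod_one_sub_affDist_le (hφ : IsAffinity φ) (hK : ∀ n, IsStoch (K n))
    (hπ : ∀ n, IsProb (π n)) (hp : ∀ n, 0 < p n) (n : ℕ) (ht : 0 ≤ t) :
    ∏ i ∈ Finset.range (n + 1), (1 - affDist φ (K i) (π i) (p i * t)) ≤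
      1 - affDist φ (productK K p n) (productPi π n) (weightSum p n * t) := by
  have hpt (i : ℕ) : 0 ≤ p i * t := mul_nonneg (hp i).le ht
  rw [le_sub_comm]
  refine affDist_le (isProb_productPi hπ n) fun x ↦ sub_le_sub_left ?_ 1
  rw [heat_productK hK hp, ← Fin.prod_univ_eq_prod_range]
  refine (Finset.prod_le_prod (fun i _ ↦ ?_) fun i _ ↦ ?_).trans (hφ.prod_aff_le
    (fun j : Fin (n + 1) ↦ isStoch_heat (hK j) (hpt j) (x j)) fun j ↦ hπ j)
  · exact sub_nonneg.2 (affDist_le_one hφ (hK i) (hπ i) (hpt i))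
  · exact sub_le_comm.1 (le_affDist hφ (hK i) (hπ i) (hpt i) (x i))

theorem isProductDist_affDist (hφ : IsAffinity φ) (h : ∀ n, IsStationaryChain (K n) (π n))
    (hp : ∀ n, 0 < p n) : IsProductDist (fun n ↦ affDist φ (K n) (π n))
      (fun n ↦ affDist φ (productK K p n) (productPi π n)) p where
  weight_pos := hp
  nonneg n _ ht := affDist_nonneg hφ (h n).stoch (h n).prob ht
  le_one n _ ht := affDist_le_one hφ (h n).stoch (h n).prob ht
  antitoneOn n := antitoneOn_affDist hφ (h n)
  prod_le_one n _ ht := affDist_le_one hφ (isStoch_productK (fun n ↦ (h n).stoch) hp n)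
    (isProb_productPi (fun n ↦ (h n).prob) n) ht
  le_prod _ _ _ hi ht :=
    affDist_le_affDist_productK hφ (fun n ↦ (h n).stoch) (fun n ↦ (h n).prob) hp hi ht
  prod_one_sub_le n _ ht :=
    prod_one_sub_affDist_le hφ (fun n ↦ (h n).stoch) (fun n ↦ (h n).prob) hp n ht

end ProductDistance

section ProductDistanceSqrt

variable {d P d' P' : ℕ → ℝ → ℝ} {p : ℕ → ℝ}

theorem IsProductDist.congr (h : IsProductDist d P p) (hd : ∀ n ⦃t⦄, 0 ≤ t → d' n t = d n t)
    (hP : ∀ n ⦃t⦄, 0 ≤ t → P' n t = P n t) : IsProductDist d' P' p := by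
  have hpt (i : ℕ) {t : ℝ} (ht : 0 ≤ t) : 0 ≤ p i * t := mul_nonneg (h.weight_pos i).le ht
  have hqt (n : ℕ) {t : ℝ} (ht : 0 ≤ t) : 0 ≤ weightSum p n * t :=
    mul_nonneg (weightSum_pos h.weight_pos n).le ht
  exact
    { weight_pos := h.weight_pos
      nonneg := fun n t ht ↦ (hd n ht).symm ▸ h.nonneg n ht
      le_one := fun n t ht ↦ (hd n ht).symm ▸ h.le_one n ht
      antitoneOn := fun n ↦ (h.antitoneOn n).congr fun t ht ↦ (hd n ht).symm
      prod_le_one := fun n t ht ↦ (hP n ht).symm ▸ h.prod_le_one n ht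
      le_prod := fun i n t hi ht ↦ by
        rw [hd i (hpt i ht), hP n (hqt n ht)]
        exact h.le_prod hi ht
      prod_one_sub_le := fun n t ht ↦ by
        rw [hP n (hqt n ht), Finset.prod_congr rfl fun i _ ↦ by rw [hd i (hpt i ht)]]
        exact h.prod_one_sub_le n ht }

theorem one_sub_prod_one_sub_sq_le {ι : Type*} {x : ι → ℝ} (h0 : ∀ i, 0 ≤ x i)
    (h1 : ∀ i, x i ≤ 1) (s : Finset ι) :
    1 - ∏ i ∈ s, (1 - x i ^ 2) ≤ (1 - ∏ i ∈ s, (1 - x i)) ^ 2 := by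
  induction s using Finset.cons_induction with
  | empty => simp
  | cons a s ha ih =>
    have u0 : 0 ≤ ∏ i ∈ s, (1 - x i) := Finset.prod_nonneg fun i _ ↦ sub_nonneg.2 (h1 i)
    have u1 : ∏ i ∈ s, (1 - x i) ≤ 1 :=
      Finset.prod_le_one (fun i _ ↦ sub_nonneg.2 (h1 i)) fun i _ ↦ sub_le_self _ (h0 i)
    rw [Finset.prod_cons, Finset.prod_cons]
    set u := ∏ i ∈ s, (1 - x i)
    have ha2 : 0 ≤ 1 - x a ^ 2 := sub_nonneg.2 (pow_le_one₀ (h0 a) (h1 a))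
    have cross : 0 ≤ x a * (1 - x a) * u * (1 - u) := mul_nonneg
      (mul_nonneg (mul_nonneg (h0 a) (sub_nonneg.2 (h1 a))) u0) (sub_nonneg.2 u1)
    linarith [mul_le_mul_of_nonneg_left ih ha2]

theorem IsProductDist.sqrt (h : IsProductDist d P p) :
    IsProductDist (fun n t ↦ √(d n t)) (fun n t ↦ √(P n t)) p where
  weight_pos := h.weight_pos
  nonneg _ _ _ := Real.sqrt_nonneg _
  le_one n _ ht := Real.sqrt_le_one.2 (h.le_one n ht)
  antitoneOn n := Real.sqrt_monotone.comp_antitoneOn (h.antitoneOn n)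
  prod_le_one n _ ht := Real.sqrt_le_one.2 (h.prod_le_one n ht)
  le_prod _ _ _ hi ht := Real.sqrt_le_sqrt (h.le_prod hi ht)
  prod_one_sub_le n t ht := by
    have hpt (i : ℕ) : 0 ≤ p i * t := mul_nonneg (h.weight_pos i).le ht
    have s0 (i : ℕ) : 0 ≤ √(d i (p i * t)) := Real.sqrt_nonneg _
    have s1 (i : ℕ) : √(d i (p i * t)) ≤ 1 := Real.sqrt_le_one.2 (h.le_one i (hpt i))
    rw [le_sub_comm]
    refine Real.sqrt_le_iff.2 ⟨sub_nonneg.2 (Finset.prod_le_one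
      (fun i _ ↦ sub_nonneg.2 (s1 i)) fun i _ ↦ sub_le_self _ (s0 i)), ?_⟩
    refine (le_sub_comm.1 (h.prod_one_sub_le n ht)).trans ?_
    simpa only [Real.sq_sqrt (h.nonneg _ (hpt _))] using
      one_sub_prod_one_sub_sq_le s0 s1 (Finset.range (n + 1))

variable {X : ℕ → Type*} {K : ∀ n, X n → X n → ℝ} {π : ∀ n, X n → ℝ}

theorem isProductDist_dTV (h : ∀ n, IsStationaryChain (K n) (π n)) (hp : ∀ n, 0 < p n) :
    IsProductDist (fun n ↦ dTV (K n) (π n)) (fun n ↦ dTV (productK K p n) (productPi π n)) p :=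
  (isProductDist_affDist isAffinity_min h hp).congr
    (fun n _ ht ↦ dTV_eq_affDist (h n).stoch (h n).prob ht)
    (fun n _ ht ↦ dTV_eq_affDist (isStoch_productK (fun n ↦ (h n).stoch) hp n)
      (isProb_productPi (fun n ↦ (h n).prob) n) ht)

theorem isProductDist_dH (h : ∀ n, IsStationaryChain (K n) (π n)) (hp : ∀ n, 0 < p n) :
    IsProductDist (fun n ↦ dH (K n) (π n)) (fun n ↦ dH (productK K p n) (productPi π n)) p :=
  (isProductDist_affDist isAffinity_geomMean h hp).sqrt.congr
    (fun n _ ht ↦ dH_eq_sqrt_affDist (h n).stoch (h n).prob ht)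
    (fun n _ ht ↦ dH_eq_sqrt_affDist (isStoch_productK (fun n ↦ (h n).stoch) hp n)
      (isProb_productPi (fun n ↦ (h n).prob) n) ht)

end ProductDistanceSqrt

/-! ### Mixing times -/

section MixingTime

variable {d : ℝ → ℝ} {e p D T t : ℝ}

theorem mixingTime_eq_ofReal (hp : 0 < p)
    (h : ENNReal.log (mixingTime d e / ENNReal.ofReal p) = (D : EReal)) :
    mixingTime d e = ENNReal.ofReal (p * Real.exp D) := by
  have ratio : mixingTime d e / ENNReal.ofReal p = ENNReal.ofReal (Real.exp D) :=
    ENNReal.log_injective <| by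
      rw [h, ENNReal.log_ofReal_of_pos (Real.exp_pos D), Real.log_exp]
  rw [ENNReal.ofReal_mul hp.le, ← ratio,
    ENNReal.mul_div_cancel (ENNReal.ofReal_pos.2 hp).ne' ENNReal.ofReal_ne_top]

theorem lt_of_lt_mixingTime (h : mixingTime d e = ENNReal.ofReal T) (ht : 0 ≤ t)
    (htT : t < T) : e < d t := by
  by_contra! hle
  have mixing_le : ENNReal.ofReal T ≤ ENNReal.ofReal t := h ▸ iInf₂_le t ⟨ht, hle⟩
  exact htT.not_ge ((ENNReal.ofReal_le_ofReal_iff ht).1 mixing_le)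

theorem le_of_mixingTime_lt (h : mixingTime d e = ENNReal.ofReal T) (hT : 0 ≤ T)
    (hd : AntitoneOn d (Set.Ici 0)) (htT : T < t) : d t ≤ e := by
  have ht := hT.trans_lt htT
  have mixing_lt : mixingTime d e < ENNReal.ofReal t :=
    h ▸ (ENNReal.ofReal_lt_ofReal_iff ht).2 htT
  obtain ⟨s, ⟨hs, hds⟩, hst⟩ :
      ∃ s, ∃ _ : 0 ≤ s ∧ d s ≤ e, ENNReal.ofReal s < ENNReal.ofReal t := by
    simpa only [mixingTime, iInf_lt_iff] using mixing_lt
  exact (hd hs ht.le ((ENNReal.ofReal_lt_ofReal_iff ht).1 hst).le).trans hds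

theorem add_one_mul_pow_le_inv_one_sub {β : ℝ} (h0 : 0 ≤ β) (h1 : β < 1) (m : ℕ) :
    (m + 1) * β ^ m ≤ (1 - β)⁻¹ :=
  calc (m + 1) * β ^ m = ∑ _j ∈ Finset.range (m + 1), β ^ m := by simp
    _ ≤ ∑ j ∈ Finset.range (m + 1), β ^ j := Finset.sum_le_sum fun _ hj ↦
      pow_le_pow_of_le_one h0 h1.le (Nat.lt_succ_iff.1 (Finset.mem_range.1 hj))
    _ ≤ ∑' j, β ^ j := (summable_geometric_of_lt_one h0 h1).sum_le_tsum _
      fun j _ ↦ pow_nonneg h0 j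
    _ = (1 - β)⁻¹ := tsum_geometric_of_lt_one h0 h1

theorem le_inv_one_sub_mul_div {β s : ℝ} (h0 : 0 ≤ β) (h1 : β < 1)
    (hd : AntitoneOn d (Set.Ici 0)) (hs : 0 < s) (hpow : ∀ m : ℕ, d (m * s) ≤ β ^ m)
    (ht : 0 < t) : d t ≤ (1 - β)⁻¹ * (s / t) := by
  set m := ⌊t / s⌋₊
  have le_t : m * s ≤ t := (le_div_iff₀ hs).1 (Nat.floor_le (div_pos ht hs).le)
  have t_le : t ≤ (m + 1) * s := ((div_lt_iff₀ hs).1 (Nat.lt_floor_add_one _)).le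
  calc d t ≤ d (m * s) := hd (mul_nonneg m.cast_nonneg hs.le) ht.le le_t
    _ ≤ β ^ m := hpow m
    _ ≤ β ^ m * ((m + 1) * s / t) :=
      le_mul_of_one_le_right (pow_nonneg h0 m) ((one_le_div ht).2 t_le)
    _ = (m + 1) * β ^ m * (s / t) := by ring
    _ ≤ (1 - β)⁻¹ * (s / t) :=
      mul_le_mul_of_nonneg_right (add_one_mul_pow_le_inv_one_sub h0 h1 m) (div_pos hs ht).le

end MixingTime

section Cutoff

variable {d P : ℕ → ℝ → ℝ} {ε T p D : ℕ → ℝ} {a b β : ℝ}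

theorem isTimeScale_of_mixingTime (hT : ∀ n, 0 < T n)
    (hd : ∀ n, AntitoneOn (d n) (Set.Ici 0))
    (hmix : ∀ n, mixingTime (d n) (ε n) = ENNReal.ofReal (T n))
    (ha : 0 < a) (hεa : ∀ n, a ≤ ε n) (hb : b < 1) (hεb : ∀ n, ε n ≤ b) (hβ0 : 0 ≤ β)
    (hβ1 : β < 1) (hpow : ∀ n s, 0 ≤ s → d n s ≤ b → ∀ m : ℕ, d n (m * s) ≤ β ^ m) :
    IsTimeScale d T where
  pos := hT
  lower := ⟨a, ha, fun n _ ht htT ↦ (hεa n).trans (lt_of_lt_mixingTime (hmix n) ht htT).le⟩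
  upper := ⟨b, hb, fun n _ htT ↦ (le_of_mixingTime_lt (hmix n) (hT n).le (hd n) htT).trans (hεb n)⟩
  decay := by
    refine ⟨2 * (1 - β)⁻¹, mul_pos two_pos (inv_pos.2 (sub_pos.2 hβ1)), fun n t ht ↦ ?_⟩
    have h2T : T n < 2 * T n := by linarith [hT n]
    have at_2T : d n (2 * T n) ≤ b :=
      (le_of_mixingTime_lt (hmix n) (hT n).le (hd n) h2T).trans (hεb n)
    have h2T0 := (hT n).trans h2T
    exact (le_inv_one_sub_mul_div hβ0 hβ1 (hd n) h2T0 (hpow n _ h2T0.le at_2T) ht).trans_eq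
      (by ring)

theorem hasGeometricGrowth_exp
    (hD : ∃ c M : ℝ, 0 < c ∧ ∀ i n : ℕ, i ≤ n → c * ((n : ℝ) - i) - M ≤ D n - D i) :
    HasGeometricGrowth fun n ↦ Real.exp (D n) := by
  obtain ⟨c, M, hc, hD⟩ := hD
  refine ⟨Real.exp M, Real.exp (-c), Real.exp_pos M, Real.exp_pos _,
    Real.exp_lt_one_iff.2 (neg_lt_zero.2 hc), fun i n hin ↦ ?_⟩
  rw [← Real.exp_nat_mul, ← Real.exp_add, ← Real.exp_add, Nat.cast_sub hin]
  exact Real.exp_le_exp.2 (by linarith [hD i n hin])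

theorem exists_linear_growth {A B C : ℕ → ℝ}
    (hA : (∀ n, 0 < A n ∧ A n ≤ A (n + 1)) ∨
      ∃ A₀ : ℝ, 0 < A₀ ∧ ∃ M : ℝ, ∀ n : ℕ, ((n : ℝ) + 1) * |A n - A₀| ≤ M)
    (hB : Monotone B) (hC : ∃ M : ℝ, ∀ n, |C n| ≤ M)
    (hD : ∀ n : ℕ, D n = A n * ((n : ℝ) + 1) + B n + C n) :
    ∃ c M : ℝ, 0 < c ∧ ∀ i n : ℕ, i ≤ n → c * ((n : ℝ) - i) - M ≤ D n - D i := by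
  obtain ⟨M, hM⟩ := hC
  have C_bound (i n : ℕ) : -(2 * M) ≤ C n - C i := by
    linarith [(abs_le.1 (hM i)).2, (abs_le.1 (hM n)).1]
  have n_pos (n : ℕ) : (0 : ℝ) ≤ n + 1 := by positivity
  rcases hA with hA | ⟨A₀, hA₀, M', hM'⟩
  · have hAm : Monotone A := monotone_nat_of_le_succ fun n ↦ (hA n).2
    refine ⟨A 0, 2 * M, (hA 0).1, fun i n hin ↦ ?_⟩
    have A_term : A 0 * ((n : ℝ) - i) ≤ A n * (n + 1) - A i * (i + 1) := by
      have := mul_le_mul_of_nonneg_right (hAm (Nat.zero_le n))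
        (sub_nonneg.2 (Nat.cast_le (α := ℝ).2 hin))
      linarith [mul_le_mul_of_nonneg_right (hAm hin) (n_pos i)]
    linarith [hD i, hD n, hB hin, C_bound i n]
  · refine ⟨A₀, 2 * M' + 2 * M, hA₀, fun i n hin ↦ ?_⟩
    have A_error (n : ℕ) : |(A n - A₀) * (n + 1)| ≤ M' := by
      rw [abs_mul, abs_of_nonneg (n_pos n), mul_comm]
      exact hM' n
    linarith [hD i, hD n, hB hin, C_bound i n, (abs_le.1 (A_error i)).2, (abs_le.1 (A_error n)).1]

theorem IsProductDist.cutoff_of_mixingTime (h : IsProductDist d P p)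
    (hmix : ∀ n, ENNReal.log (mixingTime (d n) (ε n) / ENNReal.ofReal (p n)) = (D n : EReal))
    (hgrowth : ∃ c M : ℝ, 0 < c ∧ ∀ i n : ℕ, i ≤ n → c * ((n : ℝ) - i) - M ≤ D n - D i)
    (hmono : ∃ N : ℕ, ∀ n, N ≤ n → D n ≤ D (n + 1))
    (ha : 0 < a) (hεa : ∀ n, a ≤ ε n) (hb : b < 1) (hεb : ∀ n, ε n ≤ b) (hβ0 : 0 ≤ β)
    (hβ1 : β < 1) (hpow : ∀ n s, 0 ≤ s → d n s ≤ b → ∀ m : ℕ, d n (m * s) ≤ β ^ m) :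
    (∀ t, IsCutoffTime d t → IsCutoffTime P fun n ↦ weightSum p n * t n / p n) ∧
      ((∀ ξ : ℕ → ℕ, StrictMono ξ → ¬ HasCutoff fun n ↦ d (ξ n)) → ¬ HasCutoff P) := by
  have hT : IsTimeScale d fun n ↦ p n * Real.exp (D n) :=
    isTimeScale_of_mixingTime (fun n ↦ mul_pos (h.weight_pos n) (Real.exp_pos _)) h.antitoneOn
      (fun n ↦ mixingTime_eq_ofReal (h.weight_pos n) (hmix n)) ha hεa hb hεb hβ0 hβ1 hpow
  have hE := hasGeometricGrowth_exp hgrowth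
  have hEmono : ∃ N, MonotoneOn (fun n ↦ Real.exp (D n)) (Set.Ici N) := hmono.imp fun N hN ↦
    monotoneOn_of_le_succ Set.ordConnected_Ici fun n _ hn _ ↦ Real.exp_le_exp.2 (hN n hn)
  refine ⟨fun t ht ↦ h.isCutoffTime_prod hT hE hEmono ht, fun hno hP ↦ ?_⟩
  obtain ⟨ξ, hξ, hcut⟩ := h.exists_subfamily_hasCutoff hT hE hP
  exact hno ξ hξ hcut

end Cutoff

end

end ProductChain

open ProductChain in
theorem theorem1p2_general {X : ℕ → Type*} (K : ∀ n, X n → X n → ℝ) (π : ∀ n, X n → ℝ)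
    (hchain : ∀ n, IsStationaryChain (K n) (π n)) (p : ℕ → ℝ) (hp : ∀ n, 0 < p n)
    (ε D : ℕ → ℝ) (hε_inf : ∃ a : ℝ, 0 < a ∧ ∀ n, a ≤ ε n)
    (hgrowth : ∃ c M : ℝ, 0 < c ∧ ∀ i n : ℕ, i ≤ n → c * ((n : ℝ) - i) - M ≤ D n - D i)
    (hD_mono : ∃ N : ℕ, ∀ n, N ≤ n → D n ≤ D (n + 1)) :
    ((∃ b : ℝ, b < 1 / 2 ∧ ∀ n, ε n ≤ b) →
      (∀ n, ENNReal.log (mixingTime (dTV (K n) (π n)) (ε n) / ENNReal.ofReal (p n)) =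
        (D n : EReal)) →
      (∀ t : ℕ → ℝ, IsCutoffTime (fun n ↦ dTV (K n) (π n)) t →
        IsCutoffTime (fun n ↦ dTV (productK K p n) (productPi π n))
          fun n ↦ weightSum p n * t n / p n) ∧
      ((∀ ξ : ℕ → ℕ, StrictMono ξ → ¬ HasCutoff fun n ↦ dTV (K (ξ n)) (π (ξ n))) →
        ¬ HasCutoff fun n ↦ dTV (productK K p n) (productPi π n))) ∧
    ((∃ b : ℝ, b < √2 / 4 ∧ ∀ n, ε n ≤ b) →
      (∀ n, ENNReal.log (mixingTime (dH (K n) (π n)) (ε n) / ENNReal.ofReal (p n)) =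
        (D n : EReal)) →
      (∀ t : ℕ → ℝ, IsCutoffTime (fun n ↦ dH (K n) (π n)) t →
        IsCutoffTime (fun n ↦ dH (productK K p n) (productPi π n))
          fun n ↦ weightSum p n * t n / p n) ∧
      ((∀ ξ : ℕ → ℕ, StrictMono ξ → ¬ HasCutoff fun n ↦ dH (K (ξ n)) (π (ξ n))) →
        ¬ HasCutoff fun n ↦ dH (productK K p n) (productPi π n))) := by
  obtain ⟨a, ha, hεa⟩ := hε_inf
  refine ⟨fun ⟨b, hb, hεb⟩ hmix ↦ ?_, fun ⟨b, hb, hεb⟩ hmix ↦ ?_⟩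
  · have hb0 : 0 < b := ha.trans_le ((hεa 0).trans (hεb 0))
    refine (isProductDist_dTV hchain hp).cutoff_of_mixingTime hmix hgrowth hD_mono ha hεa
      (by linarith) hεb (β := 2 * b) (by linarith) (by linarith) fun n s hs hsb m ↦ ?_
    have h0 := dTV_nonneg (hchain n).stoch (hchain n).prob hs
    exact (dTV_nat_mul_le (hchain n) hs m).trans (by gcongr)
  · have hsq : √2 * √2 = 2 := Real.mul_self_sqrt zero_le_two
    have hβ : 2 * √2 * b < 1 := by
      calc 2 * √2 * b < 2 * √2 * (√2 / 4) := by gcongr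
        _ = 1 := by linarith
    have hb1 : b < 1 := by linarith [Real.sqrt_two_lt_three_halves]
    refine (isProductDist_dH hchain hp).cutoff_of_mixingTime hmix hgrowth hD_mono ha hεa
      hb1 hεb (β := √(2 * √2 * b)) (Real.sqrt_nonneg _)
      (by rwa [Real.sqrt_lt' one_pos, one_pow]) fun n s hs hsb m ↦ ?_
    exact (dH_nat_mul_le (hchain n) hs m).trans (by gcongr)

open ProductChain in
/-- Chains are indexed from `0`: the chain, weight and constants with index `n` here are those
with index `n + 1` in the usual enumeration `1, 2, …`. -/
theorem theorem1p2 {X : ℕ → Type*} [∀ n, Countable (X n)]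
    (K : ∀ n, X n → X n → ℝ) (π : ∀ n, X n → ℝ)
    (hchain : ∀ n, ProductChain.IsIrreducibleChain (K n) (π n))
    (p : ℕ → ℝ) (hp : ∀ n, 0 < p n)
    (ε A B C : ℕ → ℝ)
    (hε_inf : ∃ a : ℝ, 0 < a ∧ ∀ n, a ≤ ε n)
    (hA : (∀ n, 0 < A n ∧ A n ≤ A (n + 1)) ∨
      ∃ A₀ : ℝ, 0 < A₀ ∧ ∃ M : ℝ, ∀ n : ℕ, ((n : ℝ) + 1) * |A n - A₀| ≤ M)
    (hB : ∀ n, B n ≤ B (n + 1))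
    (hC : ∃ M : ℝ, ∀ n, |C n| ≤ M)
    (D : ℕ → ℝ) (hD : ∀ n : ℕ, D n = A n * ((n : ℝ) + 1) + B n + C n)
    (hD_mono : ∃ N : ℕ, ∀ n, N ≤ n → D n ≤ D (n + 1)) :
    -- total variation
    ((∃ b : ℝ, b < 1 / 2 ∧ ∀ n, ε n ≤ b) →
      (∀ n, ENNReal.log (ProductChain.mixingTime (ProductChain.dTV (K n) (π n)) (ε n) /
        ENNReal.ofReal (p n)) = (D n : EReal)) →
      (∀ t : ℕ → ℝ, ProductChain.IsCutoffTime (fun n => ProductChain.dTV (K n) (π n)) t →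
        ProductChain.IsCutoffTime
          (fun n => ProductChain.dTV (ProductChain.productK K p n) (ProductChain.productPi π n))
          (fun n => ProductChain.weightSum p n * t n / p n)) ∧
      ((∀ ξ : ℕ → ℕ, StrictMono ξ →
          ¬ ProductChain.HasCutoff (fun n => ProductChain.dTV (K (ξ n)) (π (ξ n)))) →
        ¬ ProductChain.HasCutoff
          (fun n => ProductChain.dTV (ProductChain.productK K p n)
            (ProductChain.productPi π n)))) ∧
    -- Hellinger distance
    ((∃ b : ℝ, b < 1 / 4 ∧ ∀ n, ε n ≤ b) →
      (∀ n, ENNReal.log (ProductChain.mixingTime (ProductChain.dH (K n) (π n)) (ε n) /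
        ENNReal.ofReal (p n)) = (D n : EReal)) →
      (∀ t : ℕ → ℝ, ProductChain.IsCutoffTime (fun n => ProductChain.dH (K n) (π n)) t →
        ProductChain.IsCutoffTime
          (fun n => ProductChain.dH (ProductChain.productK K p n) (ProductChain.productPi π n))
          (fun n => ProductChain.weightSum p n * t n / p n)) ∧
      ((∀ ξ : ℕ → ℕ, StrictMono ξ →
          ¬ ProductChain.HasCutoff (fun n => ProductChain.dH (K (ξ n)) (π (ξ n)))) →
        ¬ ProductChain.HasCutoff
          (fun n => ProductChain.dH (ProductChain.productK K p n)
            (ProductChain.productPi π n)))) := by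
  obtain ⟨hTV, hH⟩ := theorem1p2_general K π (fun n ↦ (hchain n).isStationaryChain) p hp ε D
    hε_inf (exists_linear_growth hA (monotone_nat_of_le_succ hB) hC hD) hD_mono
  exact ⟨hTV, fun ⟨b, hb, hεb⟩ ↦ hH ⟨b, by linarith [Real.one_lt_sqrt_two], hεb⟩⟩
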